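/- Fix an integer $d$, equip $\mathbb{R}^d$ with the norm $\|x\|=\max_i|x_i|$, and let $B_1=[-1,1]^d$. Let $\mathcal{M}$ be the space of Radon (locally finite Borel) measures on $\mathbb{R}^d$, $\mathcal{M}^*=\{\mu\in\mathcal{M}:\mu(B_1)=1\}$ and $\mathcal{M}^\square=\{\mu\in\mathcal M:\mu \text{ is a probability measure on } B_1\}$. For $\mu(B_1)>0$ put $\mu^*=\mu/\mu(B_1)$ and $\mu^\square=\mu^*|_{B_1}$. Let $T_x(y)=y-x$ and $S_t(y)=e^ty$ act on measures by push-forward; a superscript $*$ or $\square$ on an operation means that the corresponding normalization is applied afterwards, e.g. $T_x^*\mu=(T_x\mu)^*$, $S_t^*\mu=(S_t\mu)^*$. A *fractal distribution* is a probability measure $P$ on $\mathcal{M}^*$ that is $S_t^*$-invariant for every $t\in\mathbb{R}$ and *quasi-Palm*: for every bounded open neighbourhood $U$ of $0$, the measures $P$ and $\int\big(\int_U\delta_{T_x^*\mu}\,d\mu(x)\big)\,dP(\mu)$ have the same null sets. Let $b\ge 2$ be an integer and let $\mathcal{D}_b$ be the partition of $\mathbb{R}^d$ into the cells $\prod_{i=1}^d[\frac{k_i}{b},\frac{k_i+2}{b})$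 with $k_i\equiv b \pmod 2$. Let $\mathcal{D}_b(x)$ be the cell containing $x$ and $T_{\mathcal{D}_b(x)}(y)=b(y-c)$, where $c$ is the centre of $\mathcal{D}_b(x)$. Put $M_b^{*}(\mu,x)=(T^{*}_{\mathcal{D}_b(x)}\mu,\;T_{\mathcal{D}_b(x)}x)$ and $M_b^{\square}(\mu,x)=(T^{\square}_{\mathcal{D}_b(x)}\mu,\;T_{\mathcal{D}_b(x)}x)$. A *restricted base-$b$ CP-distribution* is an $M_b^\square$-invariant probability measure $Q_0$ on $\mathcal{M}^\square\times B_1$ that is adapted: conditioned on the first component being $\nu$, the second component has distribution $\nu$. Its *extended version* is the distribution of $(\nu,x_0)$ on $\mathcal{M}^*\times B_1$, where $(\mu_n,x_n)_{n\in\mathbb{Z}}$ is the two-sided stationary process with marginal $Q_0$ satisfying $(\mu_{n+1},x_{n+1})=M_b^\square(\mu_n,x_n)$ for all $n$ almost surely, and almost surely $\nu(A)=\lim_{n\to\infty}\big(T^*_{\mathcal{D}_{b^n}(x_{-n})}\mu_{-n}\big)(A)$ for all Borel sets $A\subseteq\mathbb{R}^d$. A *base-$b$ CP-distribution* $Q$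 is the extended version of a restricted one. Its *continuous centering* is $$\operatorname{cent}Q=\frac{1}{\log b}\int_0^{\log b}S_t^*\big(\operatorname{cent}_0Q\big)\,dt,$$ where $\operatorname{cent}_0Q$ is the push-forward of $Q$ under $(\mu,x)\mapsto T_x^*\mu$. The *$c$-suspension* of a measure-preserving system $(\Omega,Q,f)$, $c>0$, is the semiflow $s_t(\omega,r)=\big(f^{\lfloor (r+t)/c\rfloor}\omega,\;c\{(r+t)/c\}\big)$, $t\ge0$, on $\Omega\times[0,c)$ with the product of $Q$ and normalized Lebesgue measure ($\{\cdot\}$ is the fractional part). A measure-preserving semiflow $(P,(s'_t)_{t\ge0})$ is a *factor* of $(R,(s_t)_{t\ge0})$ if there is a measurable map $\pi$ carrying $R$ to $P$ such that, for $R$-a.e. $\omega$, $\pi(s_t\omega)=s'_t\pi(\omega)$ for all $t\ge0$. **Theorem.** For every base-$b$ CP-distribution $Q$, the continuous centering $P=\operatorname{cent}Q$ is a fractal distribution. Moreover $(P,(S_t^*)_{t\ge 0})$ and the $\log b$-suspension of $(\mathcal{M}^*\times B_1,Q,M_b^*)$ are measure-preserving semiflows, and the former is a factor of the latter. -/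

import Mathlib

open MeasureTheory Set Filter Topology

noncomputable section

namespace CPCentering

/-! ### Euclidean space and Radon measures -/

/-- `ℝ^d`; the norm of a function space over `Fin d` is the supremum norm. -/
abbrev E (d : ℕ) : Type := Fin d → ℝ

/-- `B_1 = [-1,1]^d`, the closed unit ball of the supremum norm. -/
def B1 (d : ℕ) : Set (E d) := Metric.closedBall 0 1

/-- The space `𝓜` of Radon (that is, locally finite Borel) measures on `ℝ^d`. Its σ-algebra is
the one induced from `Measure (E d)`, generated by the evaluations `μ ↦ μ A` with `A` Borel; on
Radon measures it is the Borel σ-algebra of the weak-* topology. -/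
abbrev Radon (d : ℕ) : Type := {μ : Measure (E d) // IsLocallyFiniteMeasure μ}

/-- Push-forward of a locally finite measure through a homeomorphism is locally finite. -/
theorem isLocallyFiniteMeasure_map_homeomorph {d : ℕ} (f : E d ≃ₜ E d) (μ : Measure (E d))
    [IsLocallyFiniteMeasure μ] : IsLocallyFiniteMeasure (μ.map f) := by
  refine ⟨fun x => ?_⟩
  obtain ⟨s, hs, hμ⟩ := μ.finiteAt_nhds (f.symm x)
  refine ⟨f.symm ⁻¹' s, f.symm.continuous.continuousAt.preimage_mem_nhds hs, ?_⟩
  have h := f.toMeasurableEquiv.map_apply (μ := μ) (f.symm ⁻¹' s)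
  have h2 : (f.toMeasurableEquiv : E d → E d) ⁻¹' (f.symm ⁻¹' s) = s := by
    ext y; simp
  rw [h2] at h
  exact lt_of_eq_of_lt h hμ

/-- The push-forward `f μ` of a Radon measure through a homeomorphism. -/
def push {d : ℕ} (f : E d ≃ₜ E d) (μ : Radon d) : Radon d :=
  ⟨μ.1.map f, haveI := μ.2; isLocallyFiniteMeasure_map_homeomorph f μ.1⟩

/-- The normalization `μ^* = μ / μ(B_1)`. (It is only meaningful if `μ(B_1) > 0`; otherwise the
value is the zero measure by convention.) -/
def star {d : ℕ} (μ : Radon d) : Radon d :=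
  ⟨(μ.1 (B1 d)).toNNReal⁻¹ • μ.1, haveI := μ.2; inferInstance⟩

/-- The normalization `μ^□ = (μ / μ(B_1))|_{B_1}`. -/
def box {d : ℕ} (μ : Radon d) : Radon d :=
  ⟨(star μ).1.restrict (B1 d), haveI := (star μ).2; inferInstance⟩

/-- `𝓜^* = {μ : μ(B_1) = 1}`. -/
def MStar (d : ℕ) : Set (Radon d) := {μ | μ.1 (B1 d) = 1}

/-- `𝓜^□`: the probability measures on `B_1`. -/
def MBox (d : ℕ) : Set (Radon d) := {μ | μ.1 (B1 d) = 1 ∧ μ.1 (B1 d)ᶜ = 0}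

/-! ### Translation and scaling -/

/-- `T_x (y) = y - x`. -/
def trans {d : ℕ} (x : E d) : E d ≃ₜ E d := Homeomorph.subRight x

/-- `S_t (y) = e^t y`. -/
def scale {d : ℕ} (t : ℝ) : E d ≃ₜ E d :=
  Homeomorph.smulOfNeZero (Real.exp t) (Real.exp_ne_zero t)

/-- `T_x^* μ = (T_x μ)^*`. -/
def transStar {d : ℕ} (x : E d) (μ : Radon d) : Radon d := star (push (trans x) μ)

/-- `S_t^* μ = (S_t μ)^*`. -/
def scaleStar {d : ℕ} (t : ℝ) (μ : Radon d) : Radon d := star (push (scale t) μ)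

/-! ### Fractal distributions -/

/-- The diffusion `⟨μ⟩_U = ∫_U δ_{T_x^* μ} dμ(x)`. -/
def diffusion {d : ℕ} (U : Set (E d)) (μ : Radon d) : Measure (Radon d) :=
  (μ.1.restrict U).map (fun x => transStar x μ)

/-- `P` is quasi-Palm: `P` and `∫ ⟨μ⟩_U dP(μ)` have the same null sets, for every bounded open
neighbourhood `U` of the origin. -/
def QuasiPalm {d : ℕ} (P : Measure (Radon d)) : Prop :=
  ∀ U : Set (E d), IsOpen U → Bornology.IsBounded U → (0 : E d) ∈ U →
    P ≪ P.bind (diffusion U) ∧ P.bind (diffusion U) ≪ P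

/-- A fractal distribution: a probability distribution on `𝓜^*` that is invariant under `S_t^*`
for all `t ∈ ℝ` and quasi-Palm. -/
structure IsFD {d : ℕ} (P : Measure (Radon d)) : Prop where
  prob : IsProbabilityMeasure P
  mem_star : ∀ᵐ μ ∂P, μ ∈ MStar d
  invariant : ∀ t : ℝ, MeasurePreserving (scaleStar t) P P
  quasiPalm : QuasiPalm P

/-! ### The partition `𝓓_b` and magnification -/

/-- The cell `∏ᵢ [kᵢ/b, (kᵢ+2)/b)`; it belongs to `𝓓_b` when every `kᵢ ≡ b (mod 2)`. -/
def cell {d : ℕ} (b : ℕ) (k : Fin d → ℤ) : Set (E d) :=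
  {x | ∀ i, (k i : ℝ) / b ≤ x i ∧ x i < ((k i : ℝ) + 2) / b}

/-- The index of the cell `𝓓_b(x)`, see `mem_cell_iff`. -/
def cellIndex {d : ℕ} (b : ℕ) (x : E d) : Fin d → ℤ :=
  fun i => 2 * ⌊((b : ℝ) * x i + b) / 2⌋ - b

/-- `𝓓_b(x)` is the unique cell of `𝓓_b` that contains `x`. -/
theorem mem_cell_iff {d : ℕ} (b : ℕ) [NeZero b] (x : E d) (k : Fin d → ℤ) :
    (x ∈ cell b k ∧ ∀ i, k i ≡ b [ZMOD 2]) ↔ k = cellIndex b x := by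
  have hb : (0 : ℝ) < b := by exact_mod_cast Nat.pos_of_ne_zero (NeZero.ne b)
  constructor
  · rintro ⟨hx, hk⟩
    funext i
    obtain ⟨h1, h2⟩ := hx i
    rw [div_le_iff₀ hb] at h1
    rw [lt_div_iff₀ hb] at h2
    obtain ⟨j, hj⟩ : ∃ j : ℤ, k i = 2 * j - b := by
      have h := hk i
      unfold Int.ModEq at h
      exact ⟨(k i + b) / 2, by omega⟩
    have hj' : (k i : ℝ) = 2 * j - b := by exact_mod_cast hj
    have hfl : ⌊((b : ℝ) * x i + b) / 2⌋ = j := by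
      rw [Int.floor_eq_iff]
      constructor <;> nlinarith
    simp only [cellIndex, hfl, hj]
  · rintro rfl
    refine ⟨fun i => ?_, fun i => ?_⟩
    · have h1 := Int.floor_le (((b : ℝ) * x i + b) / 2)
      have h2 := Int.lt_floor_add_one (((b : ℝ) * x i + b) / 2)
      simp only [cellIndex]
      push_cast
      rw [div_le_iff₀ hb, lt_div_iff₀ hb]
      constructor <;> nlinarith
    · simp only [cellIndex]
      unfold Int.ModEq
      omega

/-- The centre of the cell `𝓓_b(x)`, a cube of radius `1/b` in the supremum norm. -/
def cellCenter {d : ℕ} (b : ℕ) (x : E d) : E d :=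
  fun i => ((cellIndex b x i : ℝ) + 1) / b

/-- `T_{𝓓_b(x)}`, the orientation-preserving homothety `y ↦ b (y - c)` with `c` the centre of
`𝓓_b(x)`; it maps the closure of `𝓓_b(x)` onto `B_1`. -/
def cellHomothety {d : ℕ} (b : ℕ) [NeZero b] (x : E d) : E d ≃ₜ E d :=
  (trans (cellCenter b x)).trans
    (Homeomorph.smulOfNeZero (b : ℝ) (Nat.cast_ne_zero.mpr (NeZero.ne b)))

/-- `M_b^* (μ, x) = (T_{𝓓_b(x)}^* μ, T_{𝓓_b(x)} x)`. -/
def magStar {d : ℕ} (b : ℕ) [NeZero b] (p : Radon d × E d) : Radon d × E d :=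
  (star (push (cellHomothety b p.2) p.1), cellHomothety b p.2 p.2)

/-- `M_b^□ (μ, x) = (T_{𝓓_b(x)}^□ μ, T_{𝓓_b(x)} x)`. -/
def magBox {d : ℕ} (b : ℕ) [NeZero b] (p : Radon d × E d) : Radon d × E d :=
  (box (push (cellHomothety b p.2) p.1), cellHomothety b p.2 p.2)

/-! ### CP-distributions -/

/-- `Q` is adapted: conditioned on the first component being `ν`, the second component is
distributed according to `ν`. -/
def Adapted {d : ℕ} (Q : Measure (Radon d × E d)) : Prop :=
  ∀ (A : Set (Radon d)) (B : Set (E d)), MeasurableSet A → MeasurableSet B →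
    Q (A ×ˢ B) = ∫⁻ p in A ×ˢ univ, p.1.1 B ∂Q

/-- A restricted base-`b` CP-distribution: an adapted probability distribution on `𝓜^□ × B_1`
that is invariant under `M_b^□`. -/
structure IsRestrictedCP {d : ℕ} (b : ℕ) [NeZero b] (Q : Measure (Radon d × E d)) : Prop where
  prob : IsProbabilityMeasure Q
  mem : ∀ᵐ p ∂Q, p.1 ∈ MBox d ∧ p.2 ∈ B1 d
  adapted : Adapted Q
  invariant : MeasurePreserving (magBox b) Q Q

/-- The measures `ν_n = T_{𝓓_{b^n}(x_{-n})}^* μ_{-n}` of a sequence `(μ_n, x_n)_{n ∈ ℤ}`. -/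
def backward {d : ℕ} (b : ℕ) [NeZero b] (ω : ℤ → Radon d × E d) (n : ℕ) : Radon d :=
  star (push (cellHomothety (b ^ n) (ω (-n)).2) (ω (-n)).1)

/-- `Qt` is the extended version of `Q`: with `(μ_n, x_n)_{n ∈ ℤ}` the two-sided stationary process
(of law `L`) that has marginal `Q` and satisfies `(μ_{n+1}, x_{n+1}) = M_b^□ (μ_n, x_n)`, and
`ν(A) = lim_n ν_n(A)` for all Borel sets `A`, the distribution of `(ν, x_0)` is `Qt`. -/
def IsExtendedVersion {d : ℕ} (b : ℕ) [NeZero b] (Q Qt : Measure (Radon d × E d)) : Prop :=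
  ∃ (L : Measure (ℤ → Radon d × E d)) (ν : (ℤ → Radon d × E d) → Radon d),
    MeasurePreserving (fun (ω : ℤ → Radon d × E d) (n : ℤ) => ω (n + 1)) L L ∧
    L.map (fun ω => ω 0) = Q ∧
    (∀ᵐ ω ∂L, ∀ n : ℤ, ω (n + 1) = magBox b (ω n)) ∧
    Measurable ν ∧
    (∀ᵐ ω ∂L, ∀ A : Set (E d), MeasurableSet A →
      Tendsto (fun n : ℕ => (backward b ω n).1 A) atTop (𝓝 ((ν ω).1 A))) ∧
    L.map (fun ω => (ν ω, (ω 0).2)) = Qt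

/-- An (extended) base-`b` CP-distribution: the extended version of a restricted one. -/
def IsCP {d : ℕ} (b : ℕ) [NeZero b] (Q : Measure (Radon d × E d)) : Prop :=
  ∃ Q₀ : Measure (Radon d × E d), IsRestrictedCP b Q₀ ∧ IsExtendedVersion b Q₀ Q

/-! ### Centering -/

/-- The discrete centering: the push-forward of `Q` through `(μ, x) ↦ T_x^* μ`. -/
def discreteCentering {d : ℕ} (Q : Measure (Radon d × E d)) : Measure (Radon d) :=
  Q.map (fun p => transStar p.2 p.1)

/-- Normalized Lebesgue measure on `[0, c)`. -/
def unifIco (c : ℝ) : Measure ℝ := (ENNReal.ofReal c)⁻¹ • volume.restrict (Ico 0 c)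

/-- The continuous centering `(1 / log b) ∫_0^{log b} S_t^* (cent_0 Q) dt`. -/
def centering {d : ℕ} (b : ℕ) (Q : Measure (Radon d × E d)) : Measure (Radon d) :=
  (unifIco (Real.log b)).bind (fun t => (discreteCentering Q).map (scaleStar t))

/-! ### Measure-preserving semiflows, suspensions and factors -/

/-- A measure-preserving semiflow `(s_t)_{t ≥ 0}` on a probability space (the action need only be
defined almost everywhere). -/
structure IsMPSemiflow {Ω : Type*} [MeasurableSpace Ω] (P : Measure Ω) (s : ℝ → Ω → Ω) :
    Prop where
  prob : IsProbabilityMeasure P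
  preserving : ∀ t : ℝ, 0 ≤ t → MeasurePreserving (s t) P P
  zero : ∀ᵐ ω ∂P, s 0 ω = ω
  add : ∀ᵐ ω ∂P, ∀ t u : ℝ, 0 ≤ t → 0 ≤ u → s (t + u) ω = s t (s u ω)

/-- The measure of the `c`-suspension of `(Ω, P, f)`; it is carried by `Ω × [0, c)`. -/
def suspMeasure {Ω : Type*} [MeasurableSpace Ω] (c : ℝ) (P : Measure Ω) : Measure (Ω × ℝ) :=
  P.prod (unifIco c)

/-- The `c`-suspension semiflow of `f`, that is, the flow under the constant function `c`:
`s_t (ω, r) = (f^⌊(r+t)/c⌋ ω, c {(r+t)/c})`. -/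
def suspFlow {Ω : Type*} (c : ℝ) (f : Ω → Ω) (t : ℝ) (p : Ω × ℝ) : Ω × ℝ :=
  (f^[⌊(p.2 + t) / c⌋₊] p.1, c * Int.fract ((p.2 + t) / c))

/-- `(P', s')` is a factor of `(P, s)`, as measure-preserving semiflows. -/
def IsFactor {Ω Ω' : Type*} [MeasurableSpace Ω] [MeasurableSpace Ω']
    (P' : Measure Ω') (s' : ℝ → Ω' → Ω') (P : Measure Ω) (s : ℝ → Ω → Ω) : Prop :=
  IsMPSemiflow P' s' ∧ IsMPSemiflow P s ∧
    ∃ π : Ω → Ω', MeasurePreserving π P P' ∧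
      ∀ᵐ ω ∂P, ∀ t : ℝ, 0 ≤ t → π (s t ω) = s' t (π ω)

end CPCentering

end

namespace CPCentering

open ProbabilityTheory
open scoped ENNReal NNReal

/-! ### Push-forwards and normalizations of Radon measures -/

variable {d : ℕ}

/-! Magnifying along cells and then centering is the same as centering and then scaling: recentring
`T^*_{𝓓_c(x)} μ` at the rescaled point gives `S^*_{log c} T_x^* μ` (`transStar_cellStar`). Hence
`((μ, x), r) ↦ S_r^* T_x^* μ` intertwines the suspension flow with scaling, and by Fubini its image
measure is `centering b Q` (`centering_eq_map`, `ae_factor`). Invariance for `t ≥ 0` descends from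
the suspension; negative times follow because scalings are invertible almost everywhere.

The argument needs two facts about the extended measure `ν`, both obtained from the two-sided
process. First, `magStar` preserves `Q`: the relation between `backward` at different times passes
to the setwise limit, so `ν` is the magnification of the `ν` of the past (`ae_eq_cellStar`,
`magStar_preserving`). Secondly, adaptedness survives the limit: given the magnified measure at time
`-n`, the point `x_0` is distributed by its restriction to `B1` (`lintegral_cell_eq`), and this
passes to `ν` since laws of setwise limits are determined by the approximating laws
(`map_eq_of_tendsto`, `IsTwoSided.adapted`).

For the quasi-Palm property, adaptedness turns statements about the marked point into statements
about `ν`-almost every point of `B1`. If the diffusion does not charge `N`, then near almost every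
point of `B1` the bad points are null, hence they are null in `B1` (`ae_of_locally_ae`), and `P`
does not charge `N`. Conversely, adaptedness alone controls only `B1`. Invariance under `S^*_{m log
b}` and the equivariance of `ν` carry the control at time `-m` to the image of `B1` under the
`m`-step magnification; these images carry all of `ν` (`ae_concentrated`, `ae_ae_spread`). -/

lemma isClosed_B1 : IsClosed (B1 d) := Metric.isClosed_closedBall

lemma measurableSet_B1 : MeasurableSet (B1 d) := isClosed_B1.measurableSet

lemma measure_lt_top_of_isCompact (μ : Radon d) {K : Set (E d)} (hK : IsCompact K) :
    μ.1 K < ∞ :=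
  haveI := μ.2
  hK.measure_lt_top

lemma isCompact_B1 : IsCompact (B1 d) := isCompact_closedBall _ _

lemma measure_preimage_B1_lt_top (f : E d ≃ₜ E d) (μ : Radon d) : μ.1 (f ⁻¹' B1 d) < ∞ :=
  measure_lt_top_of_isCompact μ (f.isCompact_preimage.mpr isCompact_B1)

lemma star_apply (μ : Radon d) (A : Set (E d)) :
    (star μ).1 A = ((μ.1 (B1 d)).toNNReal⁻¹ : ℝ≥0) * μ.1 A := rfl

lemma push_apply (f : E d ≃ₜ E d) (μ : Radon d) (A : Set (E d)) :
    (push f μ).1 A = μ.1 (f ⁻¹' A) :=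
  f.toMeasurableEquiv.map_apply A

lemma box_apply (μ : Radon d) {A : Set (E d)} (hA : MeasurableSet A) :
    (box μ).1 A = (star μ).1 (A ∩ B1 d) :=
  Measure.restrict_apply hA

lemma push_push (f g : E d ≃ₜ E d) (μ : Radon d) :
    push g (push f μ) = push (f.trans g) μ := by
  refine Subtype.ext (Measure.ext fun A _ => ?_)
  simp only [push_apply]
  rfl

lemma star_eq_self {μ : Radon d} (h : μ ∈ MStar d) : star μ = μ := by
  refine Subtype.ext (Measure.ext fun A _ => ?_)
  have h : μ.1 (B1 d) = 1 := h
  rw [star_apply, h]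
  simp

lemma star_mem_MStar {μ : Radon d} (h : μ.1 (B1 d) ≠ 0) : star μ ∈ MStar d := by
  have h2 := (measure_lt_top_of_isCompact μ isCompact_B1).ne
  change (star μ).1 (B1 d) = 1
  rw [star_apply]
  lift μ.1 (B1 d) to ℝ≥0 using h2 with m
  simp only [ENNReal.toNNReal_coe]
  rw [← ENNReal.coe_mul, inv_mul_cancel₀ (by exact_mod_cast h)]
  rfl

lemma star_apply_eq_zero_iff {μ : Radon d} (h : μ.1 (B1 d) ≠ 0) (A : Set (E d)) :
    (star μ).1 A = 0 ↔ μ.1 A = 0 := by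
  have h2 := (measure_lt_top_of_isCompact μ isCompact_B1).ne
  rw [star_apply, mul_eq_zero, or_iff_right]
  simp [ENNReal.toNNReal_eq_zero_iff, h, h2]

/-- An intermediate normalization only contributes a nonzero constant, which the outer one cancels.
The second alternative covers the degenerate convention, under which everything collapses to the
zero measure. -/
lemma star_push_star (f : E d ≃ₜ E d) {μ : Radon d}
    (h : μ.1 (B1 d) ≠ 0 ∨ μ.1 (f ⁻¹' B1 d) = 0) :
    star (push f (star μ)) = star (push f μ) := by
  refine Subtype.ext (Measure.ext fun A _ => ?_)
  have h2 := (measure_lt_top_of_isCompact μ isCompact_B1).ne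
  have h3 := (measure_preimage_B1_lt_top f μ).ne
  simp only [star_apply, push_apply]
  generalize μ.1 (f ⁻¹' A) = a
  -- Here both outer normalizing constants are the default `0⁻¹ = 0`.
  by_cases h4 : μ.1 (f ⁻¹' B1 d) = 0
  · simp [h4]
  · have h5 := h.resolve_right h4
    lift μ.1 (B1 d) to ℝ≥0 using h2 with m
    lift μ.1 (f ⁻¹' B1 d) to ℝ≥0 using h3 with k
    have hm : m ≠ 0 := by exact_mod_cast h5
    rw [ENNReal.toNNReal_coe, ← ENNReal.coe_mul, ENNReal.toNNReal_coe, ENNReal.toNNReal_coe,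
      ← mul_assoc, ← ENNReal.coe_mul]
    congr 2
    field_simp

/-! ### Measurability -/

/-- The tautological kernel that sends a Radon measure to itself. -/
noncomputable def radonKernel (d : ℕ) : Kernel (Radon d) (E d) :=
  ⟨Subtype.val, measurable_subtype_coe⟩

/-- The spherical shell `{x : j ≤ ‖x‖ < j + 1}`. -/
def shell (d j : ℕ) : Set (E d) := {x | ⌊‖x‖⌋₊ = j}

lemma measurableSet_shell (j : ℕ) : MeasurableSet (shell d j) :=
  (Nat.measurable_floor.comp measurable_norm) (measurableSet_singleton j)

lemma measure_shell_lt_top (μ : Radon d) (j : ℕ) : μ.1 (shell d j) < ∞ := by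
  refine lt_of_le_of_lt (measure_mono ?_)
    (measure_lt_top_of_isCompact μ (isCompact_closedBall (0 : E d) (j + 1)))
  intro x hx
  have := Nat.lt_floor_add_one ‖x‖
  rw [show ⌊‖x‖⌋₊ = j from hx] at this
  simpa using this.le

lemma measurable_apply {A : Set (E d)} (hA : MeasurableSet A) :
    Measurable fun μ : Radon d => μ.1 A :=
  (Measure.measurable_coe hA).comp measurable_subtype_coe

lemma measurableSet_shellMass (i : ℕ × ℕ) :
    MeasurableSet {μ : Radon d | ⌊(μ.1 (shell d i.1)).toReal⌋₊ = i.2} :=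
  (Nat.measurable_floor.comp (measurable_apply (measurableSet_shell i.1)).ennreal_toReal)
    (measurableSet_singleton i.2)

/-- The part of the tautological kernel on a shell of mass in `[k, k + 1)`. -/
noncomputable def radonKernelPiece (d : ℕ) (i : ℕ × ℕ) : Kernel (Radon d) (E d) := by
  classical
  exact Kernel.piecewise (measurableSet_shellMass i)
    ((radonKernel d).restrict (measurableSet_shell i.1)) 0

instance isFiniteKernel_radonKernelPiece (i : ℕ × ℕ) :
    IsFiniteKernel (radonKernelPiece d i) := by
  classical
  refine ⟨⟨i.2 + 1, by simp, fun μ => ?_⟩⟩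
  rw [radonKernelPiece, Kernel.piecewise_apply]
  split_ifs with h
  · rw [Kernel.restrict_apply, Measure.restrict_apply_univ]
    change μ.1 (shell d i.1) ≤ _
    have h1 := Nat.lt_floor_add_one (μ.1 (shell d i.1)).toReal
    rw [show ⌊(μ.1 (shell d i.1)).toReal⌋₊ = i.2 from h] at h1
    rw [← ENNReal.ofReal_toReal (measure_shell_lt_top μ i.1).ne]
    refine (ENNReal.ofReal_le_ofReal h1.le).trans (le_of_eq ?_)
    rw [ENNReal.ofReal_add (by positivity) (by positivity)]
    simp
  · simp

/-- A Radon measure has no uniform mass bound, so the kernel is not finite on any fixed shell.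
Sorting the measures by the integer part of the shell mass gives countably many finite kernels, of
which for each shell exactly one is active at a given measure. This makes measures of sections
measurable, on which all later measurability rests. -/
instance isSFiniteKernel_radonKernel : IsSFiniteKernel (radonKernel d) := by
  classical
  have h : radonKernel d = Kernel.sum (radonKernelPiece d) := by
    ext μ A hA
    rw [Kernel.sum_apply' _ _ hA, ENNReal.tsum_prod (f := fun j k => radonKernelPiece d (j, k) μ A)]
    have h1 : ∀ j, ∑' k, radonKernelPiece d (j, k) μ A = μ.1 (A ∩ shell d j) := by
      intro j
      rw [tsum_eq_single ⌊(μ.1 (shell d j)).toReal⌋₊]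
      · rw [radonKernelPiece, Kernel.piecewise_apply, if_pos (by simp), Kernel.restrict_apply,
          Measure.restrict_apply hA]
        rfl
      · intro k hk
        rw [radonKernelPiece, Kernel.piecewise_apply, if_neg (by simpa using hk.symm)]
        simp
    simp_rw [h1]
    rw [← measure_iUnion, ← inter_iUnion]
    · have : ⋃ j, shell d j = univ := by
        ext x
        simp [shell]
      rw [this, inter_univ]
      rfl
    · intro j k hjk
      refine Set.disjoint_left.mpr ?_
      rintro x ⟨_, hx⟩ ⟨_, hx'⟩
      exact hjk (hx.symm.trans hx')
    · exact fun j => hA.inter (measurableSet_shell j)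
  rw [h]
  exact Kernel.isSFiniteKernel_sum_of_denumerable fun _ => inferInstance

instance sigmaFinite_coe (μ : Radon d) : SigmaFinite μ.1 :=
  haveI := μ.2
  inferInstance

variable {α : Type*} [MeasurableSpace α]

lemma measurable_measure_section {m : α → Radon d} (hm : Measurable m) {S : Set (α × E d)}
    (hS : MeasurableSet S) : Measurable fun a => (m a).1 (Prod.mk a ⁻¹' S) :=
  Kernel.measurable_kernel_prodMk_left (κ := (radonKernel d).comap m hm) hS

lemma measurable_radon_iff {m : α → Radon d} :
    Measurable m ↔ ∀ A : Set (E d), MeasurableSet A → Measurable fun a => (m a).1 A :=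
  ⟨fun h _ hA => (measurable_apply hA).comp h,
    fun h => (Measure.measurable_of_measurable_coe _ h).subtype_mk⟩

lemma measurable_push {h : α → E d ≃ₜ E d} (hh : Measurable fun p : α × E d => h p.1 p.2)
    {m : α → Radon d} (hm : Measurable m) : Measurable fun a => push (h a) (m a) := by
  refine measurable_radon_iff.mpr fun A hA => ?_
  simp only [push_apply]
  exact measurable_measure_section hm (hh hA)

lemma measurable_star : Measurable (star : Radon d → Radon d) := by
  refine measurable_radon_iff.mpr fun A hA => ?_
  simp only [star_apply]
  exact ((measurable_apply measurableSet_B1).ennreal_toNNReal.inv.coe_nnreal_ennreal).mul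
    (measurable_apply hA)

lemma measurable_box : Measurable (box : Radon d → Radon d) := by
  refine measurable_radon_iff.mpr fun A hA => ?_
  simp only [box_apply _ hA]
  exact (measurable_apply (hA.inter measurableSet_B1)).comp measurable_star

lemma measurable_transStar_comp {x : α → E d} (hx : Measurable x) {m : α → Radon d}
    (hm : Measurable m) : Measurable fun a => transStar (x a) (m a) := by
  refine measurable_star.comp (measurable_push (h := fun a => trans (x a)) ?_ hm)
  exact measurable_snd.sub (hx.comp measurable_fst)

lemma measurable_scaleStar_comp {t : α → ℝ} (ht : Measurable t) {m : α → Radon d}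
    (hm : Measurable m) : Measurable fun a => scaleStar (t a) (m a) := by
  refine measurable_star.comp (measurable_push (h := fun a => scale (t a)) ?_ hm)
  exact (Real.measurable_exp.comp (ht.comp measurable_fst)).smul measurable_snd

lemma measurable_scaleStar (t : ℝ) : Measurable (scaleStar (d := d) t) :=
  measurable_scaleStar_comp measurable_const measurable_id

lemma measurable_cellIndex (b : ℕ) : Measurable (cellIndex (d := d) b) := by
  refine measurable_pi_lambda _ fun i => ?_
  have : Measurable fun x : E d => ⌊((b : ℝ) * x i + b) / 2⌋ :=
    Int.measurable_floor.comp
      ((((measurable_pi_apply i).const_mul _).add_const _).div_const _)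
  exact (measurable_from_top (f := fun n : ℤ => 2 * n - (b : ℤ))).comp this

lemma measurable_cellCenter (b : ℕ) : Measurable (cellCenter (d := d) b) := by
  refine measurable_pi_lambda _ fun i => ?_
  have : Measurable fun x : E d => cellIndex b x i :=
    (measurable_pi_apply i).comp (measurable_cellIndex b)
  exact (measurable_from_top (f := fun n : ℤ => ((n : ℝ) + 1) / b)).comp this

lemma cellHomothety_apply (b : ℕ) [NeZero b] (x y : E d) :
    cellHomothety b x y = (b : ℝ) • (y - cellCenter b x) := rfl

lemma measurable_cellHomothety_self (b : ℕ) [NeZero b] :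
    Measurable fun x : E d => cellHomothety b x x := by
  simp only [cellHomothety_apply]
  exact (measurable_id.sub (measurable_cellCenter b)).const_smul (b : ℝ)

/-- The map `(μ, x) ↦ T_{𝓓_b(x)}^* μ`. -/
noncomputable def cellStar (b : ℕ) [NeZero b] (p : Radon d × E d) : Radon d :=
  star (push (cellHomothety b p.2) p.1)

lemma measurable_push_cellHomothety (b : ℕ) [NeZero b] :
    Measurable fun p : Radon d × E d => push (cellHomothety b p.2) p.1 := by
  refine measurable_push (h := fun p : Radon d × E d => cellHomothety b p.2) ?_ measurable_fst
  simp only [cellHomothety_apply]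
  exact (measurable_snd.sub ((measurable_cellCenter b).comp
    (measurable_snd.comp measurable_fst))).const_smul (b : ℝ)

lemma measurable_cellStar (b : ℕ) [NeZero b] : Measurable (cellStar (d := d) b) :=
  measurable_star.comp (measurable_push_cellHomothety b)

lemma measurable_magStar (b : ℕ) [NeZero b] : Measurable (magStar (d := d) b) :=
  (measurable_cellStar b).prodMk ((measurable_cellHomothety_self b).comp measurable_snd)

lemma measurable_map_restrict {F : Radon d × E d → α} (hF : Measurable F) {U : Set (E d)}
    (hU : MeasurableSet U) :
    Measurable fun μ : Radon d => (μ.1.restrict U).map fun x => F (μ, x) := by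
  refine Measure.measurable_of_measurable_coe _ fun N hN => ?_
  have h2 : ∀ μ : Radon d, ((μ.1.restrict U).map fun x => F (μ, x)) N
      = μ.1 (Prod.mk μ ⁻¹' (F ⁻¹' N ∩ Prod.snd ⁻¹' U)) := by
    intro μ
    have h3 : Measurable fun x => F (μ, x) := hF.comp measurable_prodMk_left
    rw [Measure.map_apply h3 hN, Measure.restrict_apply (h3 hN)]
    rfl
  simp_rw [h2]
  exact measurable_measure_section measurable_id ((hF hN).inter (measurable_snd hU))

lemma measurable_transStar :
    Measurable fun p : Radon d × E d => transStar p.2 p.1 :=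
  measurable_transStar_comp measurable_snd measurable_fst

lemma measurable_diffusion {U : Set (E d)} (hU : MeasurableSet U) :
    Measurable (diffusion U) :=
  measurable_map_restrict measurable_transStar hU

/-! ### Scalings and translations -/

lemma scale_preimage_B1 (t : ℝ) :
    (scale t : E d ≃ₜ E d) ⁻¹' B1 d = Metric.closedBall 0 (Real.exp (-t)) := by
  ext y
  simp only [mem_preimage, B1, Metric.mem_closedBall, dist_zero_right]
  change ‖Real.exp t • y‖ ≤ 1 ↔ _
  rw [norm_smul, Real.norm_eq_abs, Real.abs_exp, Real.exp_neg, ← one_div,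
    le_div_iff₀' (Real.exp_pos t)]

lemma scale_trans_scale (t u : ℝ) :
    (scale u : E d ≃ₜ E d).trans (scale t) = scale (t + u) := by
  ext y : 1
  change Real.exp t • Real.exp u • y = Real.exp (t + u) • y
  rw [smul_smul, Real.exp_add]

lemma scaleStar_scaleStar_of_ne_zero (t u : ℝ) {μ : Radon d}
    (h : μ.1 (Metric.closedBall 0 (Real.exp (-u))) ≠ 0) :
    scaleStar t (scaleStar u μ) = scaleStar (t + u) μ := by
  rw [scaleStar, scaleStar, star_push_star, push_push, scale_trans_scale]
  · rfl
  · left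
    rwa [push_apply, scale_preimage_B1]

/-- If the inner normalization degenerates, so does the outer one: for `t ≥ 0` the later ball is
contained in the earlier one. Hence the semigroup law needs no exceptional measures. -/
lemma scaleStar_scaleStar {t u : ℝ} (ht : 0 ≤ t) (μ : Radon d) :
    scaleStar t (scaleStar u μ) = scaleStar (t + u) μ := by
  by_cases h : μ.1 (Metric.closedBall 0 (Real.exp (-u))) = 0
  · rw [scaleStar, scaleStar, star_push_star, push_push, scale_trans_scale]
    · rfl
    · right
      rw [push_apply, ← preimage_comp]
      change μ.1 (((scale u : E d ≃ₜ E d).trans (scale t)) ⁻¹' B1 d) = 0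
      rw [scale_trans_scale, scale_preimage_B1]
      refine measure_mono_null (Metric.closedBall_subset_closedBall ?_) h
      exact Real.exp_le_exp.mpr (by linarith)
  · exact scaleStar_scaleStar_of_ne_zero t u h

lemma scale_zero : (scale 0 : E d ≃ₜ E d) = Homeomorph.refl _ := by
  ext y : 1
  change Real.exp 0 • y = y
  simp

lemma scaleStar_zero (μ : Radon d) : scaleStar 0 μ = star μ := by
  rw [scaleStar, scale_zero]
  congr 1
  refine Subtype.ext (Measure.ext fun A _ => ?_)
  rw [push_apply]
  rfl

/-! ### Combinatorics of the cells -/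

/-- The half-open cube `[-1,1)^d`. -/
def halfCube (d : ℕ) : Set (E d) := {x | ∀ i, -1 ≤ x i ∧ x i < 1}

lemma measurableSet_halfCube : MeasurableSet (halfCube d) := by
  have h : halfCube d = ⋂ i, (fun x : E d => x i) ⁻¹' Ico (-1) 1 := by
    ext x
    simp [halfCube]
  rw [h]
  exact MeasurableSet.iInter fun i => measurable_pi_apply i measurableSet_Ico

lemma mem_B1_iff {x : E d} : x ∈ B1 d ↔ ∀ i, -1 ≤ x i ∧ x i ≤ 1 := by
  rw [B1, mem_closedBall_zero_iff, pi_norm_le_iff_of_nonneg zero_le_one]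
  simp [Real.norm_eq_abs, abs_le]

lemma halfCube_subset_B1 : halfCube d ⊆ B1 d := fun _ hx =>
  mem_B1_iff.mpr fun i => ⟨(hx i).1, (hx i).2.le⟩

lemma cellHomothety_apply_coord (b : ℕ) [NeZero b] (x y : E d) (i : Fin d) :
    cellHomothety b x y i = b * y i + b - 2 * ⌊((b : ℝ) * x i + b) / 2⌋ - 1 := by
  have hb : (b : ℝ) ≠ 0 := Nat.cast_ne_zero.mpr (NeZero.ne b)
  rw [cellHomothety_apply]
  simp only [Pi.smul_apply, Pi.sub_apply, smul_eq_mul, cellCenter, cellIndex]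
  push_cast
  field_simp
  ring

lemma cellHomothety_congr (b : ℕ) [NeZero b] {x y : E d} (h : cellIndex b x = cellIndex b y) :
    cellHomothety b x = cellHomothety b y := by
  ext1 z
  have h2 : cellCenter b x = cellCenter b y := funext fun i => by simp only [cellCenter, h]
  rw [cellHomothety_apply, cellHomothety_apply, h2]

lemma preimage_halfCube (b : ℕ) [NeZero b] (x : E d) :
    cellHomothety b x ⁻¹' halfCube d = {y | cellIndex b y = cellIndex b x} := by
  ext y
  have h : cellIndex b y = cellIndex b x ↔
      ∀ i, ⌊((b : ℝ) * y i + b) / 2⌋ = ⌊((b : ℝ) * x i + b) / 2⌋ := by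
    simp [funext_iff, cellIndex]
  rw [mem_preimage, mem_ofPred_eq, h]
  simp only [halfCube, mem_ofPred_eq, cellHomothety_apply_coord]
  refine forall_congr' fun i => ?_
  rw [Int.floor_eq_iff]
  constructor <;> rintro ⟨h1, h2⟩ <;> constructor <;> linarith

lemma cellHomothety_self_mem (b : ℕ) [NeZero b] (x : E d) :
    cellHomothety b x x ∈ halfCube d := by
  change x ∈ cellHomothety b x ⁻¹' halfCube d
  rw [preimage_halfCube]
  rfl

lemma preimage_B1_subset (b : ℕ) [NeZero b] {x : E d} (hx : x ∈ halfCube d) :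
    cellHomothety b x ⁻¹' B1 d ⊆ B1 d := by
  intro y hy
  have hb : (0 : ℝ) < b := by exact_mod_cast Nat.pos_of_ne_zero (NeZero.ne b)
  rw [mem_preimage, mem_B1_iff] at hy
  refine mem_B1_iff.mpr fun i => ?_
  obtain ⟨h1, h2⟩ := hy i
  obtain ⟨h3, h4⟩ := hx i
  rw [cellHomothety_apply_coord] at h1 h2
  -- The cell index of a point of the half-open cube runs through `0, …, b - 1`; the strict upper
  -- bound on `x i` keeps the last closed cell inside `B1`.
  have h5 : (0 : ℤ) ≤ ⌊((b : ℝ) * x i + b) / 2⌋ := Int.floor_nonneg.mpr (by nlinarith)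
  have h6 : ⌊((b : ℝ) * x i + b) / 2⌋ < (b : ℤ) := by
    rw [Int.floor_lt]
    push_cast
    nlinarith
  have h7 : (0 : ℝ) ≤ (⌊((b : ℝ) * x i + b) / 2⌋ : ℝ) := by exact_mod_cast h5
  have h8 : (⌊((b : ℝ) * x i + b) / 2⌋ : ℝ) + 1 ≤ b := by exact_mod_cast h6
  constructor <;> nlinarith

/-- The partitions are nested: in the floor formula, passing to the cell at level `b` subtracts an
integer, which the floor at level `c` lets through. -/
lemma cellHomothety_mul {b c e : ℕ} [NeZero b] [NeZero c] [NeZero e] (he : e = b * c)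
    (x : E d) :
    (cellHomothety b x).trans (cellHomothety c (cellHomothety b x x)) = cellHomothety e x := by
  subst he
  ext y i
  rw [Homeomorph.trans_apply]
  simp only [cellHomothety_apply_coord]
  have h : ((c : ℝ) * (b * x i + b - 2 * ⌊((b : ℝ) * x i + b) / 2⌋ - 1) + c) / 2
      = (((b * c : ℕ) : ℝ) * x i + (b * c : ℕ)) / 2
        - ((c * ⌊((b : ℝ) * x i + b) / 2⌋ : ℤ) : ℝ) := by
    push_cast
    ring
  rw [h, Int.floor_sub_intCast]
  push_cast
  ring

lemma cellHomothety_mul_self {b c e : ℕ} [NeZero b] [NeZero c] [NeZero e] (he : e = b * c)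
    (x : E d) :
    cellHomothety c (cellHomothety b x x) (cellHomothety b x x) = cellHomothety e x x := by
  rw [← cellHomothety_mul he]
  rfl

/-! ### Almost every point of a measure is charged -/

/-- There are only countably many cells, so the union of the null ones is null. -/
lemma ae_measure_cell_ne_zero (b : ℕ) (μ : Measure (E d)) :
    ∀ᵐ x ∂μ, μ {y | cellIndex b y = cellIndex b x} ≠ 0 := by
  have h : ∀ᵐ x ∂μ, ∀ k : Fin d → ℤ, μ {y | cellIndex b y = k} = 0 → cellIndex b x ≠ k := by
    refine ae_all_iff.mpr fun k => ?_
    by_cases hk : μ {y | cellIndex b y = k} = 0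
    · have : ∀ᵐ x ∂μ, cellIndex b x ≠ k := by
        rw [ae_iff]
        simpa using hk
      filter_upwards [this] with x hx _ using hx
    · exact Eventually.of_forall fun x h => absurd h hk
  filter_upwards [h] with x hx h0 using hx _ h0 rfl

lemma ae_measure_closedBall_ne_zero (μ : Measure (E d)) :
    ∀ᵐ x ∂μ, ∀ r : ℝ, 0 < r → μ (Metric.closedBall x r) ≠ 0 := by
  have h : ∀ᵐ x ∂μ, ∀ n : ℕ, μ (Metric.closedBall x (1 / (n + 1))) ≠ 0 := by
    refine ae_all_iff.mpr fun n => ?_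
    rw [ae_iff]
    -- A point whose ball is null has that ball as a null neighbourhood, so the exceptional set is
    -- locally null.
    refine measure_null_of_locally_null _ fun x hx => ?_
    refine ⟨Metric.closedBall x (1 / (n + 1)), ?_, by simpa using hx⟩
    exact mem_nhdsWithin_of_mem_nhds (Metric.closedBall_mem_nhds x (by positivity))
  filter_upwards [h] with x hx r hr h0
  obtain ⟨n, hn⟩ := exists_nat_one_div_lt hr
  exact hx n (measure_mono_null (Metric.closedBall_subset_closedBall hn.le) h0)

/-! ### Adapted distributions -/

lemma measurable_restrict_map_mk {S : Set (E d)} (hS : MeasurableSet S) :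
    Measurable fun p : Radon d × E d => (p.1.1.restrict S).map (Prod.mk p.1) :=
  (measurable_map_restrict (F := fun q : Radon d × E d => (q.1, q.2)) measurable_id hS).comp
    measurable_fst

/-- Rectangles determine a finite measure on the product, so adaptedness is a disintegration over
the first coordinate. `S` is `univ` for restricted CP-distributions and `B1` for extended ones,
whose measures may have mass outside `B1`. -/
lemma eq_bind_of_adapted {Q : Measure (Radon d × E d)} [IsFiniteMeasure Q] {S : Set (E d)}
    (hS : MeasurableSet S)
    (h : ∀ (A : Set (Radon d)) (B : Set (E d)), MeasurableSet A → MeasurableSet B →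
      Q (A ×ˢ B) = ∫⁻ p in A ×ˢ univ, p.1.1 (B ∩ S) ∂Q) :
    Q = Q.bind fun p => (p.1.1.restrict S).map (Prod.mk p.1) := by
  refine Measure.ext_prod fun {A B} hA hB => ?_
  rw [h A B hA hB, Measure.bind_apply (hA.prod hB) (measurable_restrict_map_mk hS).aemeasurable,
    ← lintegral_indicator (hA.prod MeasurableSet.univ)]
  refine lintegral_congr fun p => ?_
  rw [Measure.map_apply measurable_prodMk_left (hA.prod hB)]
  by_cases hp : p.1 ∈ A
  · rw [indicator_of_mem (by simp [hp]), mk_preimage_prod_right hp, Measure.restrict_apply hB]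
  · rw [indicator_of_notMem (by simp [hp]), mk_preimage_prod_right_eq_empty hp, measure_empty]

lemma lintegral_of_adapted {Q : Measure (Radon d × E d)} [IsFiniteMeasure Q] {S : Set (E d)}
    (hS : MeasurableSet S)
    (h : ∀ (A : Set (Radon d)) (B : Set (E d)), MeasurableSet A → MeasurableSet B →
      Q (A ×ˢ B) = ∫⁻ p in A ×ˢ univ, p.1.1 (B ∩ S) ∂Q)
    {f : Radon d × E d → ℝ≥0∞} (hf : Measurable f) :
    ∫⁻ p, f p ∂Q = ∫⁻ p, ∫⁻ x in S, f (p.1, x) ∂p.1.1 ∂Q := by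
  conv_lhs => rw [eq_bind_of_adapted hS h]
  rw [Measure.lintegral_bind (measurable_restrict_map_mk hS).aemeasurable hf.aemeasurable]
  refine lintegral_congr fun p => ?_
  rw [lintegral_map hf measurable_prodMk_left]

lemma ae_iff_of_adapted {Q : Measure (Radon d × E d)} [IsFiniteMeasure Q] {S : Set (E d)}
    (hS : MeasurableSet S)
    (h : ∀ (A : Set (Radon d)) (B : Set (E d)), MeasurableSet A → MeasurableSet B →
      Q (A ×ˢ B) = ∫⁻ p in A ×ˢ univ, p.1.1 (B ∩ S) ∂Q)
    {good : Radon d × E d → Prop} (hg : MeasurableSet {p | good p}) :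
    (∀ᵐ p ∂Q, good p) ↔ ∀ᵐ p ∂Q, ∀ᵐ x ∂(p.1.1.restrict S), good (p.1, x) := by
  have h1 := measurable_restrict_map_mk hS
  have h2 : Q {p | good p}ᶜ
      = ∫⁻ p, (p.1.1.restrict S).map (Prod.mk p.1) {p | good p}ᶜ ∂Q := by
    conv_lhs => rw [eq_bind_of_adapted hS h]
    exact Measure.bind_apply hg.compl h1.aemeasurable
  have h3 : Measurable fun p : Radon d × E d =>
      (p.1.1.restrict S).map (Prod.mk p.1) {p | good p}ᶜ :=
    (Measure.measurable_coe hg.compl).comp h1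
  change Q {p | good p}ᶜ = 0 ↔ _
  rw [h2, lintegral_eq_zero_iff h3]
  refine eventually_congr (Eventually.of_forall fun p => ?_)
  change (p.1.1.restrict S).map (Prod.mk p.1) {p | good p}ᶜ = 0 ↔ _
  rw [Measure.map_apply measurable_prodMk_left hg.compl]
  rfl

/-! ### Restricted CP-distributions -/

section Restricted

variable {b : ℕ} [NeZero b] {Q₀ : Measure (Radon d × E d)}

lemma IsRestrictedCP.adapted_univ (hQ : IsRestrictedCP b Q₀) (A : Set (Radon d))
    (B : Set (E d)) (hA : MeasurableSet A) (hB : MeasurableSet B) :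
    Q₀ (A ×ˢ B) = ∫⁻ p in A ×ˢ univ, p.1.1 (B ∩ univ) ∂Q₀ := by
  simp only [inter_univ]
  exact hQ.adapted A B hA hB

/-- A magnified point always lies in the half-open cube, and `Q₀` is its own image under
magnification. -/
lemma IsRestrictedCP.ae_snd_mem (hQ : IsRestrictedCP b Q₀) : ∀ᵐ p ∂Q₀, p.2 ∈ halfCube d := by
  rw [← hQ.invariant.map_eq, ae_map_iff hQ.invariant.measurable.aemeasurable
    (measurable_snd measurableSet_halfCube)]
  exact Eventually.of_forall fun p => cellHomothety_self_mem b p.2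

lemma IsRestrictedCP.ae_fst_compl (hQ : IsRestrictedCP b Q₀) :
    ∀ᵐ p ∂Q₀, p.1.1 (halfCube d)ᶜ = 0 := by
  have h1 := hQ.adapted univ (halfCube d)ᶜ MeasurableSet.univ measurableSet_halfCube.compl
  have h2 : Q₀ (univ ×ˢ (halfCube d)ᶜ) = 0 := by
    refine measure_mono_null ?_ hQ.ae_snd_mem
    rintro p ⟨_, hp⟩
    exact hp
  have h3 : Measurable fun p : Radon d × E d => p.1.1 (halfCube d)ᶜ :=
    (measurable_apply measurableSet_halfCube.compl).comp measurable_fst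
  rw [h2, univ_prod_univ, Measure.restrict_univ, eq_comm, lintegral_eq_zero_iff h3] at h1
  exact h1

lemma measurableSet_cell_section (b : ℕ) :
    MeasurableSet {p : Radon d × E d | p.1.1 {y | cellIndex b y = cellIndex b p.2} ≠ 0} := by
  have h : MeasurableSet {q : (Radon d × E d) × E d | cellIndex b q.2 = cellIndex b q.1.2} :=
    measurableSet_eq_fun ((measurable_cellIndex b).comp measurable_snd)
      ((measurable_cellIndex b).comp (measurable_snd.comp measurable_fst))
  exact (measurable_measure_section measurable_fst h) (measurableSet_singleton 0).compl

lemma measurableSet_closedBall_section (r : ℝ) :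
    MeasurableSet {p : Radon d × E d | p.1.1 (Metric.closedBall p.2 r) ≠ 0} := by
  have h : MeasurableSet {q : (Radon d × E d) × E d | dist q.2 q.1.2 ≤ r} :=
    measurableSet_le (measurable_snd.dist (measurable_snd.comp measurable_fst)) measurable_const
  exact (measurable_measure_section measurable_fst h) (measurableSet_singleton 0).compl

lemma IsRestrictedCP.ae_cell_ne_zero (hQ : IsRestrictedCP b Q₀) (c : ℕ) :
    ∀ᵐ p ∂Q₀, p.1.1 {y | cellIndex c y = cellIndex c p.2} ≠ 0 := by
  have := hQ.prob
  rw [ae_iff_of_adapted MeasurableSet.univ hQ.adapted_univ (measurableSet_cell_section c)]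
  refine Eventually.of_forall fun p => ?_
  rw [Measure.restrict_univ]
  exact ae_measure_cell_ne_zero c p.1.1

lemma IsRestrictedCP.ae_closedBall_ne_zero (hQ : IsRestrictedCP b Q₀) :
    ∀ᵐ p ∂Q₀, ∀ r : ℝ, 0 < r → p.1.1 (Metric.closedBall p.2 r) ≠ 0 := by
  have := hQ.prob
  have h : ∀ᵐ p ∂Q₀, ∀ n : ℕ, p.1.1 (Metric.closedBall p.2 (1 / (n + 1))) ≠ 0 := by
    refine ae_all_iff.mpr fun n => ?_
    rw [ae_iff_of_adapted MeasurableSet.univ hQ.adapted_univ (measurableSet_closedBall_section _)]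
    refine Eventually.of_forall fun p => ?_
    rw [Measure.restrict_univ]
    filter_upwards [ae_measure_closedBall_ne_zero p.1.1] with x hx using hx _ (by positivity)
  filter_upwards [h] with p hp r hr h0
  obtain ⟨n, hn⟩ := exists_nat_one_div_lt hr
  exact hp n (measure_mono_null (Metric.closedBall_subset_closedBall hn.le) h0)

lemma measure_preimage_B1_ne_zero {c : ℕ} [NeZero c] {p : Radon d × E d}
    (h : p.1.1 {y | cellIndex c y = cellIndex c p.2} ≠ 0) :
    p.1.1 (cellHomothety c p.2 ⁻¹' B1 d) ≠ 0 := by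
  rw [← preimage_halfCube] at h
  exact fun h0 => h (measure_mono_null (preimage_mono halfCube_subset_B1) h0)

/-- Cutting off outside `B1` first loses nothing, since `g` magnifies a window that already lies in
`B1`. -/
lemma box_push_box (g : E d ≃ₜ E d) (hg : g ⁻¹' B1 d ⊆ B1 d) {μ : Radon d}
    (h : μ.1 (B1 d) ≠ 0) : box (push g (box μ)) = box (push g μ) := by
  have h1 : ∀ A : Set (E d), MeasurableSet A → A ⊆ B1 d →
      (push g (box μ)).1 A = (push g (star μ)).1 A := by
    intro A hA hA'
    rw [push_apply, push_apply, box_apply _ (g.continuous.measurable hA),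
      inter_eq_left.mpr ((preimage_mono hA').trans hg)]
  rw [← Subtype.coe_inj]
  refine Measure.ext fun A hA => ?_
  have h2 : box (push g μ) = box (push g (star μ)) := by
    rw [box, box]
    simp only [star_push_star g (Or.inl h)]
  rw [h2, box_apply _ hA, box_apply _ hA, star_apply, star_apply,
    h1 _ measurableSet_B1 Subset.rfl, h1 _ (hA.inter measurableSet_B1) inter_subset_right]

lemma magBox_magBox_pow {n : ℕ} {p : Radon d × E d}
    (h : p.1.1 (cellHomothety (b ^ n) p.2 ⁻¹' B1 d) ≠ 0) :
    magBox b (magBox (b ^ n) p) = magBox (b ^ (n + 1)) p := by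
  refine Prod.ext ?_ (cellHomothety_mul_self (pow_succ b n) p.2)
  change box (push (cellHomothety b (cellHomothety (b ^ n) p.2 p.2))
    (box (push (cellHomothety (b ^ n) p.2) p.1))) = box (push (cellHomothety (b ^ (n + 1)) p.2) p.1)
  rw [box_push_box _ (preimage_B1_subset b (cellHomothety_self_mem _ _)) (by rwa [push_apply]),
    push_push, cellHomothety_mul (pow_succ b n)]

lemma box_eq_self {μ : Radon d} (h : μ ∈ MBox d) : box μ = μ := by
  rw [box, ← Subtype.coe_inj]
  simp only [star_eq_self (show μ ∈ MStar d from h.1)]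
  exact Measure.restrict_eq_self_of_ae_mem h.2

lemma cellHomothety_one {x : E d} (hx : x ∈ halfCube d) (c : ℕ) [NeZero c] (hc : c = 1) :
    cellHomothety c x = Homeomorph.refl _ := by
  subst hc
  ext y i
  have h : ⌊(((1 : ℕ) : ℝ) * x i + (1 : ℕ)) / 2⌋ = 0 := by
    obtain ⟨h1, h2⟩ := hx i
    rw [Int.floor_eq_zero_iff]
    push_cast
    constructor <;> linarith
  rw [cellHomothety_apply_coord, h]
  simp

lemma push_refl (μ : Radon d) : push (Homeomorph.refl _) μ = μ := by
  refine Subtype.ext (Measure.ext fun A _ => ?_)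
  rw [push_apply]
  rfl

lemma IsRestrictedCP.ae_iterate (hQ : IsRestrictedCP b Q₀) :
    ∀ᵐ p ∂Q₀, ∀ n : ℕ, (magBox b)^[n] p = magBox (b ^ n) p := by
  filter_upwards [hQ.mem, hQ.ae_snd_mem, ae_all_iff.mpr fun n => hQ.ae_cell_ne_zero (b ^ n)]
    with p h1 h2 h3 n
  induction n with
  -- Zero magnification is the identity only because `p.1` is already normalized on `B1` and `p.2`
  -- avoids the upper faces.
  | zero =>
    have h4 := cellHomothety_one h2 (b ^ 0) (pow_zero b)
    refine Prod.ext ?_ ?_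
    · change p.1 = box (push (cellHomothety (b ^ 0) p.2) p.1)
      rw [h4, push_refl, box_eq_self h1.1]
    · change p.2 = cellHomothety (b ^ 0) p.2 p.2
      rw [h4]
      rfl
  | succ n ih =>
    rw [Function.iterate_succ_apply', ih, magBox_magBox_pow (measure_preimage_B1_ne_zero (h3 n))]

/-- After `n` steps the law is again `Q₀`, under which the upper faces of the cube are null. Thus
the closed cube used for normalizing and the half-open cell have the same mass. -/
lemma IsRestrictedCP.ae_boundary (hQ : IsRestrictedCP b Q₀) (n : ℕ) :
    ∀ᵐ p ∂Q₀, p.1.1 (cellHomothety (b ^ n) p.2 ⁻¹' (B1 d \ halfCube d)) = 0 := by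
  have h1 := (hQ.invariant.iterate n).quasiMeasurePreserving.ae hQ.ae_fst_compl
  filter_upwards [h1, hQ.ae_iterate, hQ.ae_cell_ne_zero (b ^ n)] with p h1 h2 h3
  rw [h2 n] at h1
  change (box (push (cellHomothety (b ^ n) p.2) p.1)).1 _ = 0 at h1
  rw [box_apply _ measurableSet_halfCube.compl, star_apply_eq_zero_iff, push_apply,
    inter_comm] at h1
  · exact h1
  · rw [push_apply]
    exact measure_preimage_B1_ne_zero h3

/-- On a single cell the magnified measure is constant, while the magnified point is distributed by
it up to the mass of the cell. Summing over cells shows that the conditional law of the magnified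
point is the magnified measure on `B1`. -/
lemma lintegral_cell_eq (c : ℕ) [NeZero c] {μ : Radon d}
    (hμ : ∀ᵐ x ∂μ.1, μ.1 (cellHomothety c x ⁻¹' (B1 d \ halfCube d)) = 0)
    (G : Radon d → ℝ≥0∞) {B : Set (E d)} (hB : MeasurableSet B) :
    ∫⁻ x, G (cellStar c (μ, x)) * B.indicator 1 (cellHomothety c x x) ∂μ.1
      = ∫⁻ x, G (cellStar c (μ, x)) * (cellStar c (μ, x)).1 (B ∩ B1 d) ∂μ.1 := by
  have hF : ∀ k : Fin d → ℤ, MeasurableSet (cellIndex c ⁻¹' {k} : Set (E d)) :=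
    fun k => measurable_cellIndex c (measurableSet_singleton k)
  have hd : Pairwise (Function.onFun Disjoint fun k : Fin d → ℤ =>
      (cellIndex c ⁻¹' {k} : Set (E d))) := pairwise_disjoint_fiber _
  have hsum : ∀ f : E d → ℝ≥0∞, ∫⁻ x, f x ∂μ.1
      = ∑' k : Fin d → ℤ, ∫⁻ x in cellIndex c ⁻¹' {k}, f x ∂μ.1 := by
    intro f
    rw [← lintegral_iUnion hF hd, ← preimage_iUnion, iUnion_of_singleton, preimage_univ,
      Measure.restrict_univ]
  rw [hsum, hsum]
  refine tsum_congr fun k => ?_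
  by_cases h0 : μ.1 (cellIndex c ⁻¹' {k}) = 0
  · rw [setLIntegral_measure_zero _ _ h0, setLIntegral_measure_zero _ _ h0]
  -- A charged cell contains a point outside the exceptional null set; it serves as a representative
  -- of its cell.
  obtain ⟨x₀, hx₀, hx₀'⟩ : ∃ x₀ : E d, cellIndex c x₀ = k ∧
      μ.1 (cellHomothety c x₀ ⁻¹' (B1 d \ halfCube d)) = 0 := by
    by_contra! hcon
    refine h0 (measure_mono_null ?_ hμ)
    intro x hx
    exact hcon x hx
  have hT : ∀ x ∈ cellIndex c ⁻¹' {k}, cellHomothety c x = cellHomothety c x₀ := fun x hx =>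
    cellHomothety_congr c (by rw [hx₀]; exact hx)
  have hS : ∀ x ∈ cellIndex c ⁻¹' {k}, cellStar c (μ, x) = cellStar c (μ, x₀) := by
    intro x hx
    simp only [cellStar, hT x hx]
  have hcell : cellIndex c ⁻¹' {k} = cellHomothety c x₀ ⁻¹' halfCube d := by
    rw [preimage_halfCube, hx₀]
    rfl
  have hmeas : ∀ A : Set (E d), MeasurableSet A →
      μ.1 (cellHomothety c x₀ ⁻¹' (A ∩ B1 d)) = μ.1 (cellHomothety c x₀ ⁻¹' (A ∩ halfCube d)) := by
    intro A hA
    refine le_antisymm ?_ (measure_mono (preimage_mono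
      (inter_subset_inter_right _ halfCube_subset_B1)))
    rw [← add_zero (μ.1 (cellHomothety c x₀ ⁻¹' (A ∩ halfCube d))), ← hx₀']
    refine (measure_mono ?_).trans (measure_union_le _ _)
    rintro y ⟨hy1, hy2⟩
    by_cases hy3 : cellHomothety c x₀ y ∈ halfCube d
    · exact Or.inl ⟨hy1, hy3⟩
    · exact Or.inr ⟨hy2, hy3⟩
  have hL : ∫⁻ x in cellIndex c ⁻¹' {k},
      G (cellStar c (μ, x)) * B.indicator 1 (cellHomothety c x x) ∂μ.1
      = G (cellStar c (μ, x₀)) * μ.1 (cellHomothety c x₀ ⁻¹' (B ∩ B1 d)) := by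
    rw [setLIntegral_congr_fun (hF k) (g := fun x => G (cellStar c (μ, x₀)) *
      (cellHomothety c x₀ ⁻¹' B).indicator 1 x)]
    · have hm : MeasurableSet (cellHomothety c x₀ ⁻¹' B) :=
        (cellHomothety c x₀).continuous.measurable hB
      rw [lintegral_const_mul _ (measurable_one.indicator hm), lintegral_indicator_one hm,
        Measure.restrict_apply hm, hcell, ← preimage_inter, hmeas B hB]
    · intro x hx
      simp only [hS x hx, hT x hx]
      rfl
  have hR : ∫⁻ x in cellIndex c ⁻¹' {k},
      G (cellStar c (μ, x)) * (cellStar c (μ, x)).1 (B ∩ B1 d) ∂μ.1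
      = G (cellStar c (μ, x₀)) * (cellStar c (μ, x₀)).1 (B ∩ B1 d) * μ.1 (cellIndex c ⁻¹' {k}) := by
    rw [setLIntegral_congr_fun (hF k) (g := fun _ => G (cellStar c (μ, x₀)) *
      (cellStar c (μ, x₀)).1 (B ∩ B1 d)), setLIntegral_const]
    intro x hx
    simp only [hS x hx]
  rw [hL, hR, mul_assoc]
  congr 1
  have h1 : μ.1 (cellHomothety c x₀ ⁻¹' B1 d) = μ.1 (cellIndex c ⁻¹' {k}) := by
    have := hmeas univ MeasurableSet.univ
    rwa [univ_inter, univ_inter, ← hcell] at this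
  have h2 := (measure_preimage_B1_lt_top (cellHomothety c x₀) μ).ne
  rw [cellStar, star_apply, push_apply, push_apply]
  simp only
  rw [h1] at h2 ⊢
  generalize μ.1 (cellHomothety c x₀ ⁻¹' (B ∩ B1 d)) = a
  lift μ.1 (cellIndex c ⁻¹' {k}) to ℝ≥0 using h2 with m
  have hm : m ≠ 0 := by exact_mod_cast h0
  rw [ENNReal.toNNReal_coe, mul_right_comm, ← ENNReal.coe_mul, inv_mul_cancel₀ hm,
    ENNReal.coe_one, one_mul]

lemma measurable_measure_cell (c : ℕ) [NeZero c] {A : Set (E d)} (hA : MeasurableSet A) :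
    Measurable fun p : Radon d × E d => p.1.1 (cellHomothety c p.2 ⁻¹' A) := by
  have h := (measurable_apply hA).comp (measurable_push_cellHomothety (d := d) c)
  simpa only [Function.comp_def, push_apply] using h

lemma IsRestrictedCP.lintegral_cellStar (hQ : IsRestrictedCP b Q₀) (n : ℕ)
    {G : Radon d → ℝ≥0∞} (hG : Measurable G) {B : Set (E d)} (hB : MeasurableSet B) :
    ∫⁻ p, G (cellStar (b ^ n) p) * B.indicator 1 (cellHomothety (b ^ n) p.2 p.2) ∂Q₀
      = ∫⁻ p, G (cellStar (b ^ n) p) * (cellStar (b ^ n) p).1 (B ∩ B1 d) ∂Q₀ := by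
  have := hQ.prob
  have hc := measurable_cellStar (d := d) (b ^ n)
  have h1 : Measurable fun p : Radon d × E d =>
      G (cellStar (b ^ n) p) * B.indicator 1 (cellHomothety (b ^ n) p.2 p.2) :=
    (hG.comp hc).mul ((measurable_one.indicator hB).comp
      ((measurable_cellHomothety_self (b ^ n)).comp measurable_snd))
  have h2 : Measurable fun p : Radon d × E d =>
      G (cellStar (b ^ n) p) * (cellStar (b ^ n) p).1 (B ∩ B1 d) :=
    (hG.comp hc).mul ((measurable_apply (hB.inter measurableSet_B1)).comp hc)
  rw [lintegral_of_adapted MeasurableSet.univ hQ.adapted_univ h1,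
    lintegral_of_adapted MeasurableSet.univ hQ.adapted_univ h2]
  have hZ : MeasurableSet {p : Radon d × E d |
      p.1.1 (cellHomothety (b ^ n) p.2 ⁻¹' (B1 d \ halfCube d)) = 0} :=
    (measurable_measure_cell (b ^ n) (measurableSet_B1.diff measurableSet_halfCube))
      (measurableSet_singleton 0)
  have h := (ae_iff_of_adapted MeasurableSet.univ hQ.adapted_univ hZ).mp (hQ.ae_boundary n)
  refine lintegral_congr_ae ?_
  filter_upwards [h] with p hp
  simp only [Measure.restrict_univ] at hp ⊢
  exact lintegral_cell_eq (b ^ n) hp G hB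

end Restricted

/-! ### Setwise limits of random Radon measures -/

/-- The family of the values of a measure on all Borel sets. -/
def evals (d : ℕ) (μ : Radon d) : {A : Set (E d) // MeasurableSet A} → ℝ≥0∞ := fun A => μ.1 A.1

lemma measurable_evals : Measurable (evals d) :=
  measurable_pi_lambda _ fun A => measurable_apply A.2

lemma le_comap_evals : (inferInstance : MeasurableSpace (Radon d)) ≤
    MeasurableSpace.comap (evals d) MeasurableSpace.pi := by
  have h : @Measurable _ _ (MeasurableSpace.comap (evals d) MeasurableSpace.pi) _
      (id : Radon d → Radon d) := by
    refine (@measurable_radon_iff d (Radon d)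
      (MeasurableSpace.comap (evals d) MeasurableSpace.pi) id).mpr fun A hA => ?_
    exact (measurable_pi_apply
      (⟨A, hA⟩ : {A : Set (E d) // MeasurableSet A})).comp (comap_measurable (evals d))
  simpa using h.comap_le

lemma ext_of_map_evals {m₁ m₂ : Measure (Radon d)}
    (h : m₁.map (evals d) = m₂.map (evals d)) : m₁ = m₂ := by
  ext A hA
  obtain ⟨A', hA', rfl⟩ := le_comap_evals A hA
  rw [← Measure.map_apply measurable_evals hA', h, Measure.map_apply measurable_evals hA']

/-- Bounded continuous functions of finitely many evaluations pass to the limit by dominated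
convergence, and the laws of finitely many evaluations determine the law, because evaluations
generate the σ-algebra of `Radon d`. -/
lemma map_eq_of_tendsto {Ω : Type*} [MeasurableSpace Ω] {L₁ L₂ : Measure Ω} [IsFiniteMeasure L₁]
    [IsFiniteMeasure L₂] {νn : ℕ → Ω → Radon d} {ν : Ω → Radon d} (hνn : ∀ n, Measurable (νn n))
    (hν : Measurable ν)
    (h₁ : ∀ᵐ ω ∂L₁, ∀ A : Set (E d), MeasurableSet A →
      Tendsto (fun n => (νn n ω).1 A) atTop (𝓝 ((ν ω).1 A)))
    (h₂ : ∀ᵐ ω ∂L₂, ∀ A : Set (E d), MeasurableSet A →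
      Tendsto (fun n => (νn n ω).1 A) atTop (𝓝 ((ν ω).1 A)))
    (h : ∀ n, L₁.map (νn n) = L₂.map (νn n)) : L₁.map ν = L₂.map ν := by
  refine ext_of_map_evals ?_
  rw [Measure.map_map measurable_evals hν, Measure.map_map measurable_evals hν]
  have key : ∀ J : Finset {A : Set (E d) // MeasurableSet A},
      (L₁.map (evals d ∘ ν)).map J.restrict = (L₂.map (evals d ∘ ν)).map J.restrict := by
    intro J
    have hr : Measurable (J.restrict (π := fun _ => ℝ≥0∞)) :=
      measurable_pi_lambda _ fun i => measurable_pi_apply i.1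
    have hJ : Measurable (J.restrict (π := fun _ => ℝ≥0∞) ∘ evals d) := hr.comp measurable_evals
    rw [Measure.map_map hr (measurable_evals.comp hν),
      Measure.map_map hr (measurable_evals.comp hν), ← Function.comp_assoc]
    refine ext_of_forall_lintegral_eq_of_IsFiniteMeasure fun f => ?_
    have hf : Measurable fun x => (f x : ℝ≥0∞) :=
      f.continuous.measurable.coe_nnreal_ennreal
    rw [lintegral_map hf (hJ.comp hν), lintegral_map hf (hJ.comp hν)]
    have lim : ∀ (L : Measure Ω) [IsFiniteMeasure L], (∀ᵐ ω ∂L, ∀ A : Set (E d),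
        MeasurableSet A → Tendsto (fun n => (νn n ω).1 A) atTop (𝓝 ((ν ω).1 A))) →
        Tendsto (fun n => ∫⁻ ω, (f ((J.restrict ∘ evals d) (νn n ω)) : ℝ≥0∞) ∂L) atTop
          (𝓝 (∫⁻ ω, (f ((J.restrict ∘ evals d) (ν ω)) : ℝ≥0∞) ∂L)) := by
      intro L _ hL
      refine tendsto_lintegral_of_dominated_convergence (fun _ => (nndist 0 f : ℝ≥0∞))
        (fun n => hf.comp (hJ.comp (hνn n))) (fun n => Eventually.of_forall fun ω => ?_) ?_ ?_
      · exact ENNReal.coe_le_coe.mpr (f.apply_le_nndist_zero _)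
      · rw [lintegral_const]
        exact ENNReal.mul_ne_top ENNReal.coe_ne_top (measure_ne_top _ _)
      · filter_upwards [hL] with ω hω
        refine ENNReal.tendsto_coe.mpr ((f.continuous.tendsto _).comp ?_)
        exact tendsto_pi_nhds.mpr fun i => hω i.1.1 i.1.2
    refine tendsto_nhds_unique (lim L₁ h₁) ((lim L₂ h₂).congr fun n => ?_)
    have e := h n
    have e1 := lintegral_map (μ := L₁) (hf.comp hJ) (hνn n)
    have e2 := lintegral_map (μ := L₂) (hf.comp hJ) (hνn n)
    rw [h n, e2] at e1
    exact e1
  have hfin : ∀ J : Finset {A : Set (E d) // MeasurableSet A},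
      IsFiniteMeasure ((L₁.map (evals d ∘ ν)).map J.restrict) := fun J => inferInstance
  -- Finite measures on a product are determined by their finite-dimensional marginals.
  exact IsProjectiveLimit.unique
    (P := fun J => (L₁.map (evals d ∘ ν)).map J.restrict) (fun J => rfl) fun J => (key J).symm

lemma tendsto_star_push {νn : ℕ → Radon d} {ν : Radon d}
    (h : ∀ A : Set (E d), MeasurableSet A → Tendsto (fun n => (νn n).1 A) atTop (𝓝 (ν.1 A)))
    (f : E d ≃ₜ E d) (hf : ν.1 (f ⁻¹' B1 d) ≠ 0) {A : Set (E d)} (hA : MeasurableSet A) :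
    Tendsto (fun n => (star (push f (νn n))).1 A) atTop (𝓝 ((star (push f ν)).1 A)) := by
  simp only [star_apply, push_apply]
  have hfin := (measure_preimage_B1_lt_top f ν).ne
  have h1 := h _ (f.continuous.measurable measurableSet_B1)
  have h2 := h _ (f.continuous.measurable hA)
  have h0 : (ν.1 (f ⁻¹' B1 d)).toNNReal ≠ 0 := by
    simp [ENNReal.toNNReal_eq_zero_iff, hf, hfin]
  have h3 := ((ENNReal.tendsto_toNNReal hfin).comp h1).inv₀ h0
  refine ENNReal.Tendsto.mul (ENNReal.tendsto_coe.mpr h3) (Or.inl ?_) h2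
    (Or.inr ENNReal.coe_ne_top)
  exact_mod_cast inv_ne_zero h0

/-! ### The two-sided process -/

/-- The shift by `k` on two-sided sequences. -/
def shift {X : Type*} (k : ℤ) (ω : ℤ → X) : ℤ → X := fun n => ω (n + k)

lemma measurable_shift {X : Type*} [MeasurableSpace X] (k : ℤ) :
    Measurable (shift k : (ℤ → X) → ℤ → X) :=
  measurable_pi_lambda _ fun n => measurable_pi_apply (n + k)

lemma measurePreserving_shift {X : Type*} [MeasurableSpace X] {L : Measure (ℤ → X)}
    (h : MeasurePreserving (fun (ω : ℤ → X) (n : ℤ) => ω (n + 1)) L L) (k : ℤ) :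
    MeasurePreserving (shift k) L L := by
  have hcomp : ∀ i j : ℤ, (shift i : (ℤ → X) → ℤ → X) ∘ shift j = shift (i + j) := by
    intro i j
    funext ω n
    simp [shift, add_assoc]
  have h1 : MeasurePreserving (shift 1) L L := h
  have h2 : MeasurePreserving (shift (-1)) L L := by
    refine ⟨measurable_shift _, ?_⟩
    conv_lhs => rw [← h1.map_eq]
    rw [Measure.map_map (measurable_shift _) (measurable_shift _), hcomp]
    have : (shift (-1 + 1) : (ℤ → X) → ℤ → X) = id := by
      funext ω n
      simp [shift]
    rw [this, Measure.map_id]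
  induction k with
  | zero =>
    have : (shift 0 : (ℤ → X) → ℤ → X) = id := by
      funext ω n
      simp [shift]
    rw [this]
    exact MeasurePreserving.id L
  | succ n ih => rw [← hcomp]; exact ih.comp h1
  | pred n ih => rw [sub_eq_add_neg, ← hcomp]; exact ih.comp h2

/-- The two-sided stationary process of a restricted CP-distribution, with the setwise limit of
the measures `backward b ω n`. -/
structure IsTwoSided (b : ℕ) [NeZero b] (Q₀ : Measure (Radon d × E d))
    (L : Measure (ℤ → Radon d × E d)) (ν : (ℤ → Radon d × E d) → Radon d) : Prop where
  restricted : IsRestrictedCP b Q₀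
  stationary : MeasurePreserving (fun (ω : ℤ → Radon d × E d) (n : ℤ) => ω (n + 1)) L L
  marginal : L.map (fun ω => ω 0) = Q₀
  step : ∀ᵐ ω ∂L, ∀ n : ℤ, ω (n + 1) = magBox b (ω n)
  measurable : Measurable ν
  tendsto : ∀ᵐ ω ∂L, ∀ A : Set (E d), MeasurableSet A →
    Tendsto (fun n : ℕ => (backward b ω n).1 A) atTop (𝓝 ((ν ω).1 A))

lemma backward_eq (b : ℕ) [NeZero b] (ω : ℤ → Radon d × E d) (n : ℕ) :
    backward b ω n = cellStar (b ^ n) (ω (-n)) := rfl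

lemma measurable_backward (b : ℕ) [NeZero b] (n : ℕ) :
    Measurable fun ω : ℤ → Radon d × E d => backward b ω n :=
  (measurable_cellStar (b ^ n)).comp (measurable_pi_apply (-(n : ℤ)))

namespace IsTwoSided

variable {b : ℕ} [NeZero b] {Q₀ : Measure (Radon d × E d)}
  {L : Measure (ℤ → Radon d × E d)} {ν : (ℤ → Radon d × E d) → Radon d}

lemma shift_preserving (h : IsTwoSided b Q₀ L ν) (k : ℤ) : MeasurePreserving (shift k) L L :=
  measurePreserving_shift h.stationary k

lemma eval_preserving (h : IsTwoSided b Q₀ L ν) (k : ℤ) :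
    MeasurePreserving (fun ω : ℤ → Radon d × E d => ω k) L Q₀ := by
  have h0 : MeasurePreserving (fun ω : ℤ → Radon d × E d => ω 0) L Q₀ :=
    ⟨measurable_pi_apply 0, h.marginal⟩
  have h1 := h0.comp (h.shift_preserving k)
  simpa [Function.comp_def, shift] using h1

lemma isProbabilityMeasure (h : IsTwoSided b Q₀ L ν) : IsProbabilityMeasure L := by
  have := h.restricted.prob
  refine ⟨?_⟩
  have h1 := (h.eval_preserving 0).measure_preimage MeasurableSet.univ.nullMeasurableSet
  rw [preimage_univ] at h1
  rw [h1, measure_univ]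

lemma ae_eval (h : IsTwoSided b Q₀ L ν) {p : Radon d × E d → Prop} (hp : ∀ᵐ q ∂Q₀, p q) :
    ∀ᵐ ω ∂L, ∀ k : ℤ, p (ω k) :=
  ae_all_iff.mpr fun k => (h.eval_preserving k).quasiMeasurePreserving.ae hp

lemma ae_shift (h : IsTwoSided b Q₀ L ν) {p : (ℤ → Radon d × E d) → Prop}
    (hp : ∀ᵐ ω ∂L, p ω) : ∀ᵐ ω ∂L, ∀ k : ℤ, p (shift k ω) :=
  ae_all_iff.mpr fun k => (h.shift_preserving k).quasiMeasurePreserving.ae hp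

lemma ae_eq_magBox (h : IsTwoSided b Q₀ L ν) :
    ∀ᵐ ω ∂L, ∀ (k : ℤ) (n : ℕ), ω k = magBox (b ^ n) (ω (k - n)) := by
  filter_upwards [h.step, h.ae_eval h.restricted.ae_iterate] with ω h1 h2 k n
  rw [← h2]
  have h3 : ∀ (m : ℕ) (j : ℤ), (magBox b)^[m] (ω j) = ω (j + m) := by
    intro m j
    induction m with
    | zero => simp
    | succ m ih =>
      rw [Function.iterate_succ_apply', ih, ← h1]
      push_cast
      rw [add_assoc]
  rw [h3, sub_add_cancel]

/-- The present is the boxed `n`-fold magnification of time `-n`, so inside `B1` the backward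
measures do not depend on `n`. -/
lemma ae_backward_B1 (h : IsTwoSided b Q₀ L ν) :
    ∀ᵐ ω ∂L, ∀ (n : ℕ) (A : Set (E d)), MeasurableSet A →
      (backward b ω n).1 (A ∩ B1 d) = (ω 0).1.1 A := by
  filter_upwards [h.ae_eq_magBox] with ω h1 n A hA
  rw [h1 0 n, zero_sub]
  exact (box_apply _ hA).symm

lemma ae_limit_B1 (h : IsTwoSided b Q₀ L ν) :
    ∀ᵐ ω ∂L, ∀ A : Set (E d), MeasurableSet A → (ν ω).1 (A ∩ B1 d) = (ω 0).1.1 A := by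
  filter_upwards [h.ae_backward_B1, h.tendsto] with ω h1 h2 A hA
  refine tendsto_nhds_unique (h2 _ (hA.inter measurableSet_B1)) ?_
  simp only [h1 _ A hA]
  exact tendsto_const_nhds

lemma ae_limit_ge (h : IsTwoSided b Q₀ L ν) :
    ∀ᵐ ω ∂L, ∀ A : Set (E d), MeasurableSet A → (ω 0).1.1 A ≤ (ν ω).1 A := by
  filter_upwards [h.ae_limit_B1] with ω h1 A hA
  rw [← h1 A hA]
  exact measure_mono inter_subset_left

lemma ae_mem_MStar (h : IsTwoSided b Q₀ L ν) : ∀ᵐ ω ∂L, ν ω ∈ MStar d := by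
  filter_upwards [h.ae_limit_B1, h.ae_eval h.restricted.mem] with ω h1 h2
  have h3 := h1 _ measurableSet_B1
  rw [inter_self] at h3
  exact h3.trans (h2 0).1.1

lemma ae_closedBall_ne_zero (h : IsTwoSided b Q₀ L ν) :
    ∀ᵐ ω ∂L, ∀ r : ℝ, 0 < r → (ν ω).1 (Metric.closedBall (ω 0).2 r) ≠ 0 := by
  filter_upwards [h.ae_limit_ge, h.ae_eval h.restricted.ae_closedBall_ne_zero] with ω h1 h2 r hr h0
  exact h2 0 r hr (le_antisymm ((h1 _ Metric.isClosed_closedBall.measurableSet).trans h0.le) bot_le)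

lemma ae_cell_ne_zero (h : IsTwoSided b Q₀ L ν) :
    ∀ᵐ ω ∂L, ∀ n : ℕ, (ν ω).1 (cellHomothety (b ^ n) (ω 0).2 ⁻¹' B1 d) ≠ 0 := by
  filter_upwards [h.ae_limit_ge, h.ae_eval (ae_all_iff.mpr fun n : ℕ =>
    h.restricted.ae_cell_ne_zero (b ^ n))] with ω h1 h2 n h0
  refine measure_preimage_B1_ne_zero (h2 0 n) (le_antisymm ((h1 _ ?_).trans h0.le) bot_le)
  exact (cellHomothety (b ^ n) (ω 0).2).continuous.measurable measurableSet_B1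

lemma ae_backward_shift (h : IsTwoSided b Q₀ L ν) :
    ∀ᵐ ω ∂L, ∀ m k : ℕ, backward b ω (k + m)
      = cellStar (b ^ m) (backward b (shift (-m) ω) k, (ω (-m)).2) := by
  filter_upwards [h.ae_eq_magBox, h.ae_eval (ae_all_iff.mpr fun n : ℕ =>
    h.restricted.ae_cell_ne_zero (b ^ n))] with ω h1 h2 m k
  have h3 : shift (-m) ω (-k) = ω (-m - k) := by
    simp only [shift]
    congr 1
    ring
  have h4 : -((k + m : ℕ) : ℤ) = -m - k := by
    push_cast
    ring
  have h5 : (ω (-m)).2 = cellHomothety (b ^ k) (ω (-m - k)).2 (ω (-m - k)).2 :=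
    congrArg Prod.snd (h1 (-m) k)
  rw [backward_eq, backward_eq, h3, h4]
  simp only [cellStar]
  rw [star_push_star, push_push, h5, cellHomothety_mul (pow_add b k m)]
  left
  rw [push_apply]
  exact measure_preimage_B1_ne_zero (h2 _ k)

lemma ae_eq_cellStar (h : IsTwoSided b Q₀ L ν) :
    ∀ᵐ ω ∂L, ∀ m : ℕ, ν ω = cellStar (b ^ m) (ν (shift (-m) ω), (ω (-m)).2) := by
  filter_upwards [h.ae_backward_shift, h.tendsto, h.ae_shift h.tendsto,
    h.ae_shift h.ae_cell_ne_zero] with ω h1 h2 h3 h4 m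
  refine Subtype.ext (Measure.ext fun A hA => ?_)
  have h5 := h4 (-m) m
  simp only [shift, zero_add] at h5
  have h6 := tendsto_star_push (h3 (-m)) (cellHomothety (b ^ m) (ω (-m)).2) h5 hA
  refine tendsto_nhds_unique ((tendsto_add_atTop_iff_nat m).mpr (h2 A hA)) ?_
  simp only [h1 m]
  exact h6

/-- Each backward measure lives on one of these cubes, because `(ω (-n)).1` lives on `B1`. Setwise
convergence, applied to the complement of the union, passes this to `ν`. -/
lemma ae_concentrated (h : IsTwoSided b Q₀ L ν) :
    ∀ᵐ ω ∂L, (ν ω).1 (⋃ m : ℕ, cellHomothety (b ^ m) (ω (-m)).2 '' B1 d)ᶜ = 0 := by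
  filter_upwards [h.tendsto, h.ae_eval h.restricted.mem] with ω h1 h2
  have hm : MeasurableSet (⋃ m : ℕ, cellHomothety (b ^ m) (ω (-m)).2 '' B1 d)ᶜ :=
    (MeasurableSet.iUnion fun m : ℕ =>
      ((cellHomothety (b ^ m) (ω (-m)).2).isClosedMap _ isClosed_B1).measurableSet).compl
  refine tendsto_nhds_unique (h1 _ hm) ?_
  have h3 : ∀ n : ℕ, (backward b ω n).1
      (⋃ m : ℕ, cellHomothety (b ^ m) (ω (-m)).2 '' B1 d)ᶜ = 0 := by
    intro n
    rw [backward, star_apply, push_apply, mul_eq_zero]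
    right
    rw [push_apply]
    refine measure_mono_null ?_ (h2 (-n)).1.2
    intro y hy hy'
    exact hy (mem_iUnion.mpr ⟨n, mem_image_of_mem _ hy'⟩)
  simp only [h3]
  exact tendsto_const_nhds

lemma measurable_pair (h : IsTwoSided b Q₀ L ν) :
    Measurable fun ω : ℤ → Radon d × E d => (ν ω, (ω 0).2) :=
  h.measurable.prodMk (measurable_snd.comp (measurable_pi_apply 0))

lemma cellStar_congr {b c : ℕ} [NeZero b] [NeZero c] (h : b = c) (p : Radon d × E d) :
    cellStar b p = cellStar c p := by
  subst h
  rfl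

lemma ae_magStar (h : IsTwoSided b Q₀ L ν) :
    ∀ᵐ ω ∂L, (ν (shift 1 ω), (shift 1 ω 0).2) = magStar b (ν ω, (ω 0).2) := by
  filter_upwards [h.ae_shift h.ae_eq_cellStar, h.step] with ω h1 h2
  have h3 := h1 1 1
  have h4 : shift (-(1 : ℕ)) (shift 1 ω) = ω := by
    funext n
    simp [shift]
  rw [h4, cellStar_congr (pow_one b)] at h3
  have h5 : (shift 1 ω 0).2 = (magBox b (ω 0)).2 := congrArg Prod.snd (h2 0)
  refine Prod.ext ?_ h5
  simpa [shift] using! h3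

lemma magStar_preserving (h : IsTwoSided b Q₀ L ν) :
    MeasurePreserving (magStar b) (L.map fun ω => (ν ω, (ω 0).2))
      (L.map fun ω => (ν ω, (ω 0).2)) := by
  refine ⟨measurable_magStar b, ?_⟩
  rw [Measure.map_map (measurable_magStar b) h.measurable_pair]
  conv_rhs => rw [← (h.shift_preserving 1).map_eq]
  rw [Measure.map_map h.measurable_pair (measurable_shift 1)]
  refine Measure.map_congr ?_
  filter_upwards [h.ae_magStar] with ω hω
  exact hω.symm

lemma lintegral_backward (h : IsTwoSided b Q₀ L ν) (n : ℕ) {G : Radon d → ℝ≥0∞}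
    (hG : Measurable G) {B : Set (E d)} (hB : MeasurableSet B) :
    ∫⁻ ω, G (backward b ω n) * B.indicator 1 (ω 0).2 ∂L
      = ∫⁻ ω, G (backward b ω n) * (ω 0).1.1 B ∂L := by
  have hc := measurable_cellStar (d := d) (b ^ n)
  have h1 : Measurable fun p : Radon d × E d =>
      G (cellStar (b ^ n) p) * B.indicator 1 (cellHomothety (b ^ n) p.2 p.2) :=
    (hG.comp hc).mul ((measurable_one.indicator hB).comp
      ((measurable_cellHomothety_self (b ^ n)).comp measurable_snd))
  have h2 : Measurable fun p : Radon d × E d =>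
      G (cellStar (b ^ n) p) * (cellStar (b ^ n) p).1 (B ∩ B1 d) :=
    (hG.comp hc).mul ((measurable_apply (hB.inter measurableSet_B1)).comp hc)
  have h3 := h.restricted.lintegral_cellStar n hG hB
  rw [← (h.eval_preserving (-n)).lintegral_comp h1,
    ← (h.eval_preserving (-n)).lintegral_comp h2] at h3
  convert h3 using 1
  · refine lintegral_congr_ae ?_
    filter_upwards [h.ae_eq_magBox] with ω hω
    have h5 : (ω 0).2 = cellHomothety (b ^ n) (ω (-n)).2 (ω (-n)).2 := by
      have := congrArg Prod.snd (hω 0 n)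
      rwa [zero_sub] at this
    rw [h5, backward_eq]
  · refine lintegral_congr_ae ?_
    filter_upwards [h.ae_backward_B1] with ω hω
    rw [← hω n B hB, backward_eq]

lemma adapted (h : IsTwoSided b Q₀ L ν) {A : Set (Radon d)} {B : Set (E d)}
    (hA : MeasurableSet A) (hB : MeasurableSet B) :
    (L.map fun ω => (ν ω, (ω 0).2)) (A ×ˢ B)
      = ∫⁻ p in A ×ˢ univ, p.1.1 (B ∩ B1 d) ∂(L.map fun ω => (ν ω, (ω 0).2)) := by
  have := h.isProbabilityMeasure
  have hx : Measurable fun ω : ℤ → Radon d × E d => (ω 0).2 :=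
    measurable_snd.comp (measurable_pi_apply 0)
  have hw : Measurable fun ω : ℤ → Radon d × E d => (ω 0).1.1 B :=
    (measurable_apply hB).comp (measurable_fst.comp (measurable_pi_apply 0))
  have hw1 : ∀ᵐ ω ∂L, (ω 0).1.1 B ≤ 1 := by
    filter_upwards [h.ae_limit_B1, h.ae_mem_MStar] with ω h1 h2
    rw [← h1 B hB]
    exact (measure_mono inter_subset_right).trans (le_of_eq h2)
  have hfin : IsFiniteMeasure (L.withDensity fun ω => (ω 0).1.1 B) := by
    refine isFiniteMeasure_withDensity (ne_of_lt ?_)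
    calc ∫⁻ ω, (ω 0).1.1 B ∂L ≤ ∫⁻ _, 1 ∂L := lintegral_mono_ae hw1
      _ < ∞ := by simp
  -- Conditioning directly on `ν` is avoided: two measures on the path space, one restricted to `x_0
  -- ∈ B` and one weighted by `μ_0(B)`, have equal images under every backward measure, hence under
  -- the limit.
  have hmap : (L.restrict ((fun ω => (ω 0).2) ⁻¹' B)).map ν
      = (L.withDensity fun ω => (ω 0).1.1 B).map ν := by
    refine map_eq_of_tendsto (fun n => measurable_backward b n) h.measurable
      (ae_restrict_of_ae h.tendsto) ((withDensity_absolutelyContinuous L _).ae_le h.tendsto)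
      fun n => ?_
    ext A' hA'
    have hn := measurable_backward (d := d) b n hA'
    rw [Measure.map_apply (measurable_backward b n) hA',
      Measure.map_apply (measurable_backward b n) hA', Measure.restrict_apply hn,
      withDensity_apply _ hn]
    have h1 := h.lintegral_backward n (measurable_one.indicator hA') hB
    rw [← lintegral_indicator_one (hn.inter (hx hB)), ← lintegral_indicator hn]
    convert h1 using 1
    · refine lintegral_congr fun ω => ?_
      by_cases h2 : backward b ω n ∈ A' <;> by_cases h3 : (ω 0).2 ∈ B <;>
        simp [indicator, h2, h3]
    · refine lintegral_congr fun ω => ?_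
      by_cases h2 : backward b ω n ∈ A' <;> simp [indicator, h2]
  have e := congrArg (fun m => m A) hmap
  simp only [Measure.map_apply h.measurable hA, Measure.restrict_apply (h.measurable hA),
    withDensity_apply _ (h.measurable hA)] at e
  have hAu : MeasurableSet (A ×ˢ (univ : Set (E d))) := hA.prod MeasurableSet.univ
  have hev : Measurable fun p : Radon d × E d => p.1.1 (B ∩ B1 d) :=
    (measurable_apply (hB.inter measurableSet_B1)).comp measurable_fst
  rw [Measure.map_apply h.measurable_pair (hA.prod hB),
    setLIntegral_map hAu hev h.measurable_pair]
  have hpre : (fun ω : ℤ → Radon d × E d => (ν ω, (ω 0).2)) ⁻¹' (A ×ˢ univ) = ν ⁻¹' A := by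
    ext ω
    simp
  rw [hpre]
  refine e.trans (lintegral_congr_ae (ae_restrict_of_ae ?_))
  filter_upwards [h.ae_limit_B1] with ω hω
  exact (hω B hB).symm

end IsTwoSided

/-! ### Suspensions -/

lemma isProbabilityMeasure_unifIco {c : ℝ} (hc : 0 < c) : IsProbabilityMeasure (unifIco c) := by
  refine ⟨?_⟩
  rw [unifIco, Measure.smul_apply, Measure.restrict_apply_univ, Real.volume_Ico, sub_zero,
    smul_eq_mul, ENNReal.inv_mul_cancel (by simpa using hc) ENNReal.ofReal_ne_top]

lemma ae_mem_unifIco (c : ℝ) : ∀ᵐ r ∂unifIco c, r ∈ Ico 0 c :=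
  Measure.ae_smul_measure (ae_restrict_mem measurableSet_Ico) _

/-- The integrand is periodic, and any two intervals of length `c` are fundamental domains for `cℤ`.
-/
lemma lintegral_unifIco_rotate {c : ℝ} (hc : 0 < c) (t : ℝ) (h : ℝ → ℝ≥0∞) :
    ∫⁻ r, h (c * Int.fract ((r + t) / c)) ∂unifIco c = ∫⁻ r, h r ∂unifIco c := by
  have hfd : ∀ s : ℝ, IsAddFundamentalDomain (AddSubgroup.zmultiples c) (Ioc s (s + c)) volume :=
    fun s => isAddFundamentalDomain_Ioc hc s
  have hper : ∀ (g : AddSubgroup.zmultiples c) (x : ℝ),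
      h (c * Int.fract ((g +ᵥ x) / c)) = h (c * Int.fract (x / c)) := by
    rintro ⟨_, n, rfl⟩ x
    have : ((⟨n • c, n, rfl⟩ : AddSubgroup.zmultiples c) +ᵥ x) / c = n + x / c := by
      change (n • c + x) / c = _
      rw [zsmul_eq_mul]
      field_simp
    rw [this, Int.fract_intCast_add]
  have h1 : ∫⁻ r in Ioc 0 c, h (c * Int.fract ((r + t) / c))
      = ∫⁻ r in Ioc t (t + c), h (c * Int.fract (r / c)) := by
    rw [← (measurePreserving_add_right volume t).setLIntegral_comp_preimage_emb
      (measurableEmbedding_addRight t) (fun r => h (c * Int.fract (r / c))) (Ioc t (t + c))]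
    congr 2
    ext r
    simp only [mem_preimage, mem_Ioc]
    constructor <;> rintro ⟨_, _⟩ <;> constructor <;> linarith
  have h2 : ∫⁻ r in Ioc t (t + c), h (c * Int.fract (r / c))
      = ∫⁻ r in Ioc 0 c, h (c * Int.fract (r / c)) := by
    have := (hfd t).setLIntegral_eq (hfd 0) (fun r => h (c * Int.fract (r / c))) hper
    rwa [zero_add] at this
  rw [unifIco, lintegral_smul_measure, lintegral_smul_measure,
    restrict_Ico_eq_restrict_Ioc, h1, h2, ← restrict_Ico_eq_restrict_Ioc]
  congr 1
  refine setLIntegral_congr_fun measurableSet_Ico fun r hr => ?_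
  rw [Int.fract_eq_self.mpr ⟨div_nonneg hr.1 hc.le, (div_lt_one hc).mpr hr.2⟩,
    mul_div_cancel₀ _ hc.ne']

section Suspension

variable {Ω : Type*} {f : Ω → Ω} {c : ℝ}

lemma suspFlow_zero (hc : 0 < c) {p : Ω × ℝ} (hp : p.2 ∈ Ico 0 c) : suspFlow c f 0 p = p := by
  have h1 : 0 ≤ p.2 / c := div_nonneg hp.1 hc.le
  have h2 : p.2 / c < 1 := (div_lt_one hc).mpr hp.2
  rw [suspFlow, add_zero, Nat.floor_eq_zero.mpr h2, Int.fract_eq_self.mpr ⟨h1, h2⟩,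
    mul_div_cancel₀ _ hc.ne']
  rfl

lemma suspFlow_add (hc : 0 < c) {p : Ω × ℝ} (hp : 0 ≤ p.2) {t u : ℝ} (ht : 0 ≤ t) (hu : 0 ≤ u) :
    suspFlow c f (t + u) p = suspFlow c f t (suspFlow c f u p) := by
  have h0 : 0 ≤ (p.2 + u) / c := by positivity
  have h1 : (p.2 + u) / c = ⌊(p.2 + u) / c⌋₊ + Int.fract ((p.2 + u) / c) := by
    rw [natCast_floor_eq_intCast_floor h0]
    exact (Int.floor_add_fract _).symm
  have h5 : ∀ y : ℝ, (c * y + t) / c = y + t / c := fun y => by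
    rw [add_div, mul_div_cancel_left₀ _ hc.ne']
  have h2 : (p.2 + (t + u)) / c
      = ⌊(p.2 + u) / c⌋₊ + (c * Int.fract ((p.2 + u) / c) + t) / c := by
    have : (p.2 + (t + u)) / c = (p.2 + u) / c + t / c := by ring
    rw [this, h5]
    linarith
  have h3 : 0 ≤ (c * Int.fract ((p.2 + u) / c) + t) / c := by
    have := Int.fract_nonneg ((p.2 + u) / c)
    positivity
  simp only [suspFlow]
  rw [h2, Int.fract_natCast_add, add_comm (_ : ℝ), Nat.floor_add_natCast h3,
    Function.iterate_add_apply]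

variable [MeasurableSpace Ω] {Q : Measure Ω}

lemma measurable_iterate (hf : Measurable f) : Measurable fun q : Ω × ℕ => f^[q.2] q.1 :=
  measurable_from_prod_countable_left fun n => hf.iterate n

lemma measurable_suspFlow (hf : Measurable f) (c t : ℝ) : Measurable (suspFlow c f t) := by
  have h1 : Measurable fun p : Ω × ℝ => (p.2 + t) / c :=
    (measurable_snd.add_const t).div_const c
  exact ((measurable_iterate hf).comp (measurable_fst.prodMk (Nat.measurable_floor.comp h1))).prodMk
    ((measurable_fract.comp h1).const_mul c)

lemma suspFlow_preserving [IsProbabilityMeasure Q] (hf : MeasurePreserving f Q Q) (hc : 0 < c)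
    (t : ℝ) : MeasurePreserving (suspFlow c f t) (suspMeasure c Q) (suspMeasure c Q) := by
  have := isProbabilityMeasure_unifIco hc
  have hm := measurable_suspFlow hf.measurable c t
  refine ⟨hm, ?_⟩
  ext A hA
  rw [Measure.map_apply hm hA, suspMeasure, Measure.prod_apply_symm (hm hA),
    Measure.prod_apply_symm hA, ← lintegral_unifIco_rotate hc t fun r => Q ((fun x => (x, r)) ⁻¹' A)]
  refine lintegral_congr fun r => ?_
  -- For fixed `r` the number of applications of `f` is fixed, so each fibre contributes by
  -- invariance of `Q`.
  exact (hf.iterate ⌊(r + t) / c⌋₊).measure_preimage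
    (measurable_prodMk_right (y := c * Int.fract ((r + t) / c)) hA).nullMeasurableSet

lemma ae_snd_mem_suspMeasure [SFinite Q] (hc : 0 < c) :
    ∀ᵐ p ∂suspMeasure c Q, p.2 ∈ Ico 0 c := by
  have := isProbabilityMeasure_unifIco hc
  exact Measure.quasiMeasurePreserving_snd.ae (ae_mem_unifIco c)

lemma isMPSemiflow_suspFlow [IsProbabilityMeasure Q] (hf : MeasurePreserving f Q Q)
    (hc : 0 < c) : IsMPSemiflow (suspMeasure c Q) (suspFlow c f) where
  prob := by
    have := isProbabilityMeasure_unifIco hc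
    rw [suspMeasure]
    infer_instance
  preserving t _ := suspFlow_preserving hf hc t
  zero := by
    filter_upwards [ae_snd_mem_suspMeasure hc] with p hp using suspFlow_zero hc hp
  add := by
    filter_upwards [ae_snd_mem_suspMeasure hc] with p hp t u ht hu
      using suspFlow_add hc hp.1 ht hu

end Suspension

/-! ### Magnification at a point -/

lemma scaleStar_star {t : ℝ} (ht : 0 ≤ t) (μ : Radon d) : scaleStar t (star μ) = scaleStar t μ := by
  refine star_push_star _ ?_
  rw [scale_preimage_B1]
  refine (em (μ.1 (B1 d) = 0)).symm.imp_right fun h => measure_mono_null ?_ h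
  exact Metric.closedBall_subset_closedBall (Real.exp_le_one_iff.mpr (by linarith))

lemma scaleStar_zero_transStar (x : E d) (μ : Radon d) :
    scaleStar 0 (transStar x μ) = transStar x μ := by
  rw [transStar, scaleStar_star le_rfl, scaleStar_zero]

lemma transStar_cellStar (c : ℕ) [NeZero c] (x y : E d) {μ : Radon d}
    (h : μ.1 (cellHomothety c x ⁻¹' B1 d) ≠ 0) :
    transStar (cellHomothety c x y) (cellStar c (μ, x))
      = scaleStar (Real.log c) (transStar y μ) := by
  have hc : (0 : ℝ) < c := by exact_mod_cast Nat.pos_of_ne_zero (NeZero.ne c)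
  have hc1 : (1 : ℝ) ≤ c := by exact_mod_cast Nat.pos_of_ne_zero (NeZero.ne c)
  have e : (cellHomothety c x).trans (trans (cellHomothety c x y))
      = (trans y).trans (scale (Real.log c)) := by
    ext1 z
    change (c : ℝ) • (z - cellCenter c x) - (c : ℝ) • (y - cellCenter c x)
      = Real.exp (Real.log c) • (z - y)
    rw [Real.exp_log hc, ← smul_sub, sub_sub_sub_cancel_right]
  rw [transStar, cellStar, star_push_star, push_push, e, transStar,
    scaleStar_star (Real.log_nonneg hc1), scaleStar, push_push]
  left
  rwa [push_apply]

lemma transStar_iterate_magStar (b : ℕ) [NeZero b] {p : Radon d × E d}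
    (h : ∀ n : ℕ, ((magStar b)^[n] p).1.1
      (cellHomothety b ((magStar b)^[n] p).2 ⁻¹' B1 d) ≠ 0) (n : ℕ) :
    transStar ((magStar b)^[n] p).2 ((magStar b)^[n] p).1
      = scaleStar (n * Real.log b) (transStar p.2 p.1) := by
  induction n with
  | zero => simp [scaleStar_zero_transStar]
  | succ n ih =>
    have hb1 : (1 : ℝ) ≤ b := by exact_mod_cast Nat.pos_of_ne_zero (NeZero.ne b)
    rw [Function.iterate_succ_apply']
    refine (transStar_cellStar b _ _ (h n)).trans ?_
    rw [ih, scaleStar_scaleStar (Real.log_nonneg hb1)]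
    congr 1
    push_cast
    ring

/-- The factor map `((μ, x), r) ↦ S_r^* T_x^* μ` of the suspension onto the centering. -/
noncomputable def factorMap (q : (Radon d × E d) × ℝ) : Radon d :=
  scaleStar q.2 (transStar q.1.2 q.1.1)

lemma measurable_factorMap : Measurable (factorMap (d := d)) :=
  measurable_scaleStar_comp measurable_snd (measurable_transStar.comp measurable_fst)

/-- The homothety `y ↦ e^r (y - x)`. -/
noncomputable def zoom (x : E d) (r : ℝ) : E d ≃ₜ E d := (trans x).trans (scale r)

lemma zoom_apply (x : E d) (r : ℝ) (y : E d) : zoom x r y = Real.exp r • (y - x) := rfl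

lemma zoom_preimage_closedBall (x : E d) (r ρ : ℝ) :
    zoom x r ⁻¹' Metric.closedBall 0 ρ = Metric.closedBall x (Real.exp (-r) * ρ) := by
  ext y
  rw [mem_preimage, mem_closedBall_zero_iff, zoom_apply, norm_smul, Real.norm_eq_abs,
    Real.abs_exp, Metric.mem_closedBall, dist_eq_norm, Real.exp_neg, ← div_eq_inv_mul,
    le_div_iff₀' (Real.exp_pos r)]

lemma factorMap_eq {p : Radon d × E d} {r : ℝ} (hr : 0 ≤ r) :
    factorMap (p, r) = star (push (zoom p.2 r) p.1) := by
  rw [factorMap, transStar, scaleStar_star hr, scaleStar, push_push, zoom]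

lemma push_zoom_B1_ne_zero {p : Radon d × E d}
    (hp : ∀ ρ : ℝ, 0 < ρ → p.1.1 (Metric.closedBall p.2 ρ) ≠ 0) (r : ℝ) :
    (push (zoom p.2 r) p.1).1 (B1 d) ≠ 0 := by
  rw [push_apply, B1, zoom_preimage_closedBall]
  exact hp _ (by positivity)

lemma factorMap_apply_eq_zero_iff {p : Radon d × E d}
    (hp : ∀ ρ : ℝ, 0 < ρ → p.1.1 (Metric.closedBall p.2 ρ) ≠ 0) {r : ℝ} (hr : 0 ≤ r)
    (A : Set (E d)) : (factorMap (p, r)).1 A = 0 ↔ p.1.1 (zoom p.2 r ⁻¹' A) = 0 := by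
  rw [factorMap_eq hr, star_apply_eq_zero_iff (push_zoom_B1_ne_zero hp r), push_apply]

/-- The homothety `zoom` turns differences `z - x` into `e^r (z - x)`, so the old centre drops out.
The diffusion of a centered measure thereby becomes a statement about the points of the original
measure. -/
lemma transStar_factorMap {p : Radon d × E d}
    (hp : ∀ ρ : ℝ, 0 < ρ → p.1.1 (Metric.closedBall p.2 ρ) ≠ 0) {r : ℝ} (hr : 0 ≤ r) (x : E d) :
    transStar (zoom p.2 r x) (factorMap (p, r)) = scaleStar r (transStar x p.1) := by
  have e : (zoom p.2 r).trans (trans (zoom p.2 r x)) = (trans x).trans (scale r) := by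
    ext1 z
    change Real.exp r • (z - p.2) - Real.exp r • (x - p.2) = Real.exp r • (z - x)
    rw [← smul_sub, sub_sub_sub_cancel_right]
  rw [factorMap_eq hr, transStar, star_push_star _ (Or.inl (push_zoom_B1_ne_zero hp r)), push_push,
    e, transStar, scaleStar_star hr, scaleStar, push_push]

lemma diffusion_apply {U : Set (E d)} (μ : Radon d) {N : Set (Radon d)} (hN : MeasurableSet N) :
    diffusion U μ N = μ.1 {y | y ∈ U ∧ transStar y μ ∈ N} := by
  have h : Measurable fun y => transStar y μ := measurable_transStar_comp measurable_id measurable_const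
  rw [diffusion, Measure.map_apply h hN, Measure.restrict_apply (h hN), inter_comm]
  rfl

lemma diffusion_factorMap_eq_zero_iff {p : Radon d × E d}
    (hp : ∀ ρ : ℝ, 0 < ρ → p.1.1 (Metric.closedBall p.2 ρ) ≠ 0) {r : ℝ} (hr : 0 ≤ r)
    (U : Set (E d)) {N : Set (Radon d)} (hN : MeasurableSet N) :
    diffusion U (factorMap (p, r)) N = 0
      ↔ p.1.1 {x | zoom p.2 r x ∈ U ∧ scaleStar r (transStar x p.1) ∈ N} = 0 := by
  rw [diffusion_apply _ hN, factorMap_apply_eq_zero_iff hp hr]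
  simp only [preimage_ofPred_eq, transStar_factorMap hp hr]

/-! ### Extended CP-distributions and their centerings -/

/-- The properties of extended CP-distributions that do not involve the past of the process. -/
structure IsExtendedCP (b : ℕ) [NeZero b] (Q : Measure (Radon d × E d)) : Prop where
  prob : IsProbabilityMeasure Q
  preserving : MeasurePreserving (magStar b) Q Q
  charged : ∀ᵐ p ∂Q, ∀ r : ℝ, 0 < r → p.1.1 (Metric.closedBall p.2 r) ≠ 0
  cell : ∀ᵐ p ∂Q, p.1.1 (cellHomothety b p.2 ⁻¹' B1 d) ≠ 0
  adapted : ∀ (A : Set (Radon d)) (B : Set (E d)), MeasurableSet A → MeasurableSet B →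
    Q (A ×ˢ B) = ∫⁻ p in A ×ˢ univ, p.1.1 (B ∩ B1 d) ∂Q

lemma cellHomothety_congr_base {b c : ℕ} [NeZero b] [NeZero c] (h : b = c) (x : E d) :
    cellHomothety b x = cellHomothety c x := by
  subst h
  rfl

lemma IsTwoSided.isExtendedCP {b : ℕ} [NeZero b] {Q₀ : Measure (Radon d × E d)}
    {L : Measure (ℤ → Radon d × E d)} {ν : (ℤ → Radon d × E d) → Radon d}
    (h : IsTwoSided b Q₀ L ν) : IsExtendedCP b (L.map fun ω => (ν ω, (ω 0).2)) where
  prob := by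
    have := h.isProbabilityMeasure
    exact Measure.isProbabilityMeasure_map h.measurable_pair.aemeasurable
  preserving := h.magStar_preserving
  charged := by
    have h1 : ∀ᵐ p ∂(L.map fun ω => (ν ω, (ω 0).2)), ∀ n : ℕ,
        p.1.1 (Metric.closedBall p.2 (1 / (n + 1))) ≠ 0 := by
      refine ae_all_iff.mpr fun n => ?_
      rw [ae_map_iff h.measurable_pair.aemeasurable (measurableSet_closedBall_section _)]
      filter_upwards [h.ae_closedBall_ne_zero] with ω hω using hω _ (by positivity)
    filter_upwards [h1] with p hp r hr h0
    obtain ⟨n, hn⟩ := exists_nat_one_div_lt hr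
    exact hp n (measure_mono_null (Metric.closedBall_subset_closedBall hn.le) h0)
  cell := by
    have hm : MeasurableSet {p : Radon d × E d | p.1.1 (cellHomothety b p.2 ⁻¹' B1 d) ≠ 0} :=
      (measurable_measure_cell b measurableSet_B1) (measurableSet_singleton 0).compl
    rw [ae_map_iff h.measurable_pair.aemeasurable hm]
    filter_upwards [h.ae_cell_ne_zero] with ω hω
    have := hω 1
    rwa [cellHomothety_congr_base (pow_one b)] at this
  adapted _ _ hA hB := h.adapted hA hB

namespace IsExtendedCP

variable {b : ℕ} [NeZero b] {Q : Measure (Radon d × E d)}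

lemma centering_eq_map (h : IsExtendedCP b Q) (hb : 2 ≤ b) :
    centering b Q = (suspMeasure (Real.log b) Q).map factorMap := by
  have := h.prob
  have hc : 0 < Real.log b := Real.log_pos (by exact_mod_cast hb)
  have := isProbabilityMeasure_unifIco hc
  have h2 : ∀ (t : ℝ) (A : Set (Radon d)), MeasurableSet A →
      ((discreteCentering Q).map (scaleStar t)) A = Q ((fun p => (p, t)) ⁻¹' (factorMap ⁻¹' A)) := by
    intro t A hA
    rw [discreteCentering, Measure.map_map (measurable_scaleStar t) measurable_transStar,
      Measure.map_apply ((measurable_scaleStar t).comp measurable_transStar) hA]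
    rfl
  have h3 : Measurable fun t : ℝ => (discreteCentering Q).map (scaleStar t) := by
    refine Measure.measurable_of_measurable_coe _ fun A hA => ?_
    simp only [h2 _ A hA]
    exact measurable_measure_prodMk_right (measurable_factorMap hA)
  ext A hA
  rw [centering, Measure.bind_apply hA h3.aemeasurable, Measure.map_apply measurable_factorMap hA,
    suspMeasure, Measure.prod_apply_symm (measurable_factorMap hA)]
  exact lintegral_congr fun t => h2 t A hA

lemma isProbabilityMeasure_centering (h : IsExtendedCP b Q) (hb : 2 ≤ b) :
    IsProbabilityMeasure (centering b Q) := by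
  have := h.prob
  have := isProbabilityMeasure_unifIco (c := Real.log b) (Real.log_pos (by exact_mod_cast hb))
  rw [h.centering_eq_map hb, suspMeasure]
  exact Measure.isProbabilityMeasure_map measurable_factorMap.aemeasurable

lemma ae_susp (h : IsExtendedCP b Q) (hb : 2 ≤ b) :
    ∀ᵐ q ∂suspMeasure (Real.log b) Q,
      (∀ r : ℝ, 0 < r → q.1.1.1 (Metric.closedBall q.1.2 r) ≠ 0) ∧ 0 ≤ q.2 := by
  have := h.prob
  have hc : 0 < Real.log b := Real.log_pos (by exact_mod_cast hb)
  have := isProbabilityMeasure_unifIco hc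
  have h1 := Measure.quasiMeasurePreserving_fst (μ := Q) (ν := unifIco (Real.log b)) |>.ae h.charged
  filter_upwards [h1, ae_snd_mem_suspMeasure (Q := Q) hc] with q h1 h2 using ⟨h1, h2.1⟩

lemma ae_factor (h : IsExtendedCP b Q) (hb : 2 ≤ b) :
    ∀ᵐ q ∂suspMeasure (Real.log b) Q, ∀ t : ℝ, 0 ≤ t →
      factorMap (suspFlow (Real.log b) (magStar b) t q) = scaleStar t (factorMap q) := by
  have := h.prob
  have hc : 0 < Real.log b := Real.log_pos (by exact_mod_cast hb)
  have := isProbabilityMeasure_unifIco hc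
  -- One null set serves all times `t`: only the countably many iterates matter.
  have h0 : ∀ᵐ p ∂Q, ∀ n : ℕ, ((magStar b)^[n] p).1.1
      (cellHomothety b ((magStar b)^[n] p).2 ⁻¹' B1 d) ≠ 0 :=
    ae_all_iff.mpr fun n => (h.preserving.iterate n).quasiMeasurePreserving.ae h.cell
  have h1 := Measure.quasiMeasurePreserving_fst (μ := Q) (ν := unifIco (Real.log b)) |>.ae h0
  filter_upwards [h1, ae_snd_mem_suspMeasure (Q := Q) hc] with q h1 h2 t ht
  have h3 : 0 ≤ (q.2 + t) / Real.log b := div_nonneg (add_nonneg h2.1 ht) hc.le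
  simp only [factorMap, suspFlow]
  rw [transStar_iterate_magStar b h1, scaleStar_scaleStar
    (mul_nonneg hc.le (Int.fract_nonneg _)), scaleStar_scaleStar ht,
    natCast_floor_eq_intCast_floor h3]
  congr 1
  have h4 := Int.floor_add_fract ((q.2 + t) / Real.log b)
  calc Real.log b * Int.fract ((q.2 + t) / Real.log b) + ⌊(q.2 + t) / Real.log b⌋ * Real.log b
      = Real.log b * (⌊(q.2 + t) / Real.log b⌋ + Int.fract ((q.2 + t) / Real.log b)) := by ring
    _ = t + q.2 := by rw [h4, mul_div_cancel₀ _ hc.ne', add_comm]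

lemma scaleStar_preserving_of_nonneg (h : IsExtendedCP b Q) (hb : 2 ≤ b) {t : ℝ} (ht : 0 ≤ t) :
    MeasurePreserving (scaleStar t) (centering b Q) (centering b Q) := by
  have := h.prob
  have hc : 0 < Real.log b := Real.log_pos (by exact_mod_cast hb)
  have hs := suspFlow_preserving h.preserving hc t
  refine ⟨measurable_scaleStar t, ?_⟩
  rw [h.centering_eq_map hb, Measure.map_map (measurable_scaleStar t) measurable_factorMap]
  conv_rhs => rw [← hs.map_eq]
  rw [Measure.map_map measurable_factorMap hs.measurable]
  refine Measure.map_congr ?_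
  filter_upwards [h.ae_factor hb] with q hq using (hq t ht).symm

lemma ae_centering_closedBall (h : IsExtendedCP b Q) (hb : 2 ≤ b) {ρ : ℝ} (hρ : 0 < ρ) :
    ∀ᵐ μ ∂centering b Q, μ.1 (Metric.closedBall 0 ρ) ≠ 0 := by
  have hm : MeasurableSet {μ : Radon d | μ.1 (Metric.closedBall 0 ρ) ≠ 0} :=
    measurable_apply Metric.isClosed_closedBall.measurableSet (measurableSet_singleton 0).compl
  rw [h.centering_eq_map hb, ae_map_iff measurable_factorMap.aemeasurable hm]
  filter_upwards [h.ae_susp hb] with q hq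
  rw [Ne, factorMap_apply_eq_zero_iff hq.1 hq.2, zoom_preimage_closedBall]
  exact hq.1 _ (by positivity)

lemma ae_centering_mem_MStar (h : IsExtendedCP b Q) (hb : 2 ≤ b) :
    ∀ᵐ μ ∂centering b Q, μ ∈ MStar d := by
  have hm : MeasurableSet {μ : Radon d | μ ∈ MStar d} :=
    measurable_apply measurableSet_B1 (measurableSet_singleton 1)
  rw [h.centering_eq_map hb, ae_map_iff measurable_factorMap.aemeasurable hm]
  filter_upwards [h.ae_susp hb] with q hq
  change factorMap (q.1, q.2) ∈ MStar d
  rw [factorMap_eq hq.2]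
  exact star_mem_MStar (push_zoom_B1_ne_zero hq.1 q.2)

lemma scaleStar_preserving (h : IsExtendedCP b Q) (hb : 2 ≤ b) (t : ℝ) :
    MeasurePreserving (scaleStar t) (centering b Q) (centering b Q) := by
  rcases le_total 0 t with ht | ht
  · exact h.scaleStar_preserving_of_nonneg hb ht
  have h1 := h.scaleStar_preserving_of_nonneg hb (neg_nonneg.mpr ht)
  refine ⟨measurable_scaleStar t, ?_⟩
  conv_lhs => rw [← h1.map_eq]
  rw [Measure.map_map (measurable_scaleStar t) h1.measurable]
  conv_rhs => rw [← Measure.map_id (μ := centering b Q)]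
  refine Measure.map_congr ?_
  -- The ball at the origin that `S_{-t}` maps onto `B1` is charged, so scaling by `-t` can be
  -- undone.
  filter_upwards [h.ae_centering_closedBall hb (Real.exp_pos (- -t)), h.ae_centering_mem_MStar hb]
    with μ h2 h3
  rw [Function.comp_apply, scaleStar_scaleStar_of_ne_zero _ _ h2, add_neg_cancel, scaleStar_zero,
    star_eq_self h3, id]

lemma isMPSemiflow_centering (h : IsExtendedCP b Q) (hb : 2 ≤ b) :
    IsMPSemiflow (centering b Q) scaleStar where
  prob := h.isProbabilityMeasure_centering hb
  preserving t _ := h.scaleStar_preserving hb t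
  zero := by
    filter_upwards [h.ae_centering_mem_MStar hb] with μ hμ
    rw [scaleStar_zero, star_eq_self hμ]
  add := Eventually.of_forall fun μ _ _ ht _ => (scaleStar_scaleStar ht μ).symm

lemma isFactor_centering (h : IsExtendedCP b Q) (hb : 2 ≤ b) :
    IsFactor (centering b Q) scaleStar (suspMeasure (Real.log b) Q)
      (suspFlow (Real.log b) (magStar b)) := by
  have := h.prob
  exact ⟨h.isMPSemiflow_centering hb,
    isMPSemiflow_suspFlow h.preserving (Real.log_pos (by exact_mod_cast hb)), factorMap,
    ⟨measurable_factorMap, (h.centering_eq_map hb).symm⟩, h.ae_factor hb⟩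

end IsExtendedCP

/-! ### The quasi-Palm property -/

/-- Around each point that satisfies the local hypothesis the bad points form a null set, and
locally null sets are null. -/
lemma ae_of_locally_ae {μ : Measure (E d)} {V : Set (E d)} (hV : V ∈ 𝓝 (0 : E d))
    {good : E d → Prop} {S : Set (E d)}
    (h : ∀ᵐ x ∂μ.restrict S, μ {y | y - x ∈ V ∧ ¬ good y} = 0) :
    ∀ᵐ x ∂μ.restrict S, good x := by
  have h1 : μ.restrict S {x | μ {y | y - x ∈ V ∧ ¬ good y} = 0 ∧ ¬ good x} = 0 := by
    refine measure_null_of_locally_null _ fun x hx => ?_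
    refine ⟨{x | μ {y | y - x ∈ V ∧ ¬ good y} = 0 ∧ ¬ good x} ∩ {y | y - x ∈ V}, ?_, ?_⟩
    · refine inter_mem_nhdsWithin _ ?_
      have : Tendsto (fun y => y - x) (𝓝 x) (𝓝 (x - x)) := tendsto_id.sub_const x
      rw [sub_self] at this
      exact this hV
    · refine le_antisymm ((Measure.restrict_apply_le _ _).trans ?_) bot_le
      refine le_of_le_of_eq (measure_mono ?_) hx.1
      rintro y ⟨⟨_, hy⟩, hyV⟩
      exact ⟨hyV, hy⟩
  have h2 : ∀ᵐ x ∂μ.restrict S, ¬ (μ {y | y - x ∈ V ∧ ¬ good y} = 0 ∧ ¬ good x) := by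
    rw [ae_iff]
    simpa using h1
  filter_upwards [h, h2] with x hx hx2
  by_contra h3
  exact hx2 ⟨hx, h3⟩

/-- The points `((μ, x), r)` for which `S_r^* T_x^* μ ∈ N`. -/
lemma measurableSet_zoomed {N : Set (Radon d)} (hN : MeasurableSet N) :
    MeasurableSet {q : (Radon d × E d) × ℝ | scaleStar q.2 (transStar q.1.2 q.1.1) ∈ N} :=
  measurable_factorMap hN

lemma measurable_zoomed_base {α : Type*} [MeasurableSpace α] {r : α → ℝ} {x : α → E d}
    {μ : α → Radon d} (hr : Measurable r) (hx : Measurable x) (hμ : Measurable μ) :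
    Measurable fun a => scaleStar (r a) (transStar (x a) (μ a)) :=
  measurable_scaleStar_comp hr (measurable_transStar_comp hx hμ)

namespace IsExtendedCP

variable {b : ℕ} [NeZero b] {Q : Measure (Radon d × E d)}

lemma centering_apply_eq_zero_iff (h : IsExtendedCP b Q) (hb : 2 ≤ b) {N : Set (Radon d)}
    (hN : MeasurableSet N) : centering b Q N = 0 ↔
      ∀ᵐ p ∂Q, ∀ᵐ r ∂unifIco (Real.log b), scaleStar r (transStar p.2 p.1) ∉ N := by
  have := isProbabilityMeasure_unifIco (c := Real.log b) (Real.log_pos (by exact_mod_cast hb))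
  rw [h.centering_eq_map hb, Measure.map_apply measurable_factorMap hN, suspMeasure,
    Measure.measure_prod_null (measurable_factorMap hN)]
  refine eventually_congr (Eventually.of_forall fun p => ?_)
  simp only [ae_iff, not_not]
  rfl

lemma bind_diffusion_eq_zero_iff (h : IsExtendedCP b Q) (hb : 2 ≤ b) {U : Set (E d)}
    (hU : MeasurableSet U) {N : Set (Radon d)} (hN : MeasurableSet N) :
    (centering b Q).bind (diffusion U) N = 0 ↔
      ∀ᵐ q ∂suspMeasure (Real.log b) Q,
        q.1.1.1 {x | zoom q.1.2 q.2 x ∈ U ∧ scaleStar q.2 (transStar x q.1.1) ∈ N} = 0 := by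
  have h1 : Measurable fun μ : Radon d => diffusion U μ N :=
    (Measure.measurable_coe hN).comp (measurable_diffusion hU)
  have h2 : MeasurableSet {μ : Radon d | diffusion U μ N = 0} := h1 (measurableSet_singleton 0)
  rw [Measure.bind_apply hN (measurable_diffusion hU).aemeasurable, lintegral_eq_zero_iff h1]
  change (∀ᵐ μ ∂centering b Q, diffusion U μ N = 0) ↔ _
  rw [h.centering_eq_map hb, ae_map_iff measurable_factorMap.aemeasurable h2]
  refine eventually_congr ?_
  filter_upwards [h.ae_susp hb] with q hq
  exact diffusion_factorMap_eq_zero_iff hq.1 hq.2 U hN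

lemma absolutelyContinuous_bind (h : IsExtendedCP b Q) (hb : 2 ≤ b) {U : Set (E d)}
    (hU : IsOpen U) (h0 : (0 : E d) ∈ U) :
    centering b Q ≪ (centering b Q).bind (diffusion U) := by
  refine Measure.AbsolutelyContinuous.mk fun N hN hnull => ?_
  have := h.prob
  have hc : 0 < Real.log b := Real.log_pos (by exact_mod_cast hb)
  have := isProbabilityMeasure_unifIco hc
  rw [h.bind_diffusion_eq_zero_iff hb hU.measurableSet hN] at hnull
  have hS : MeasurableSet {q : ((Radon d × E d) × ℝ) × E d | zoom q.1.1.2 q.1.2 q.2 ∈ U ∧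
      scaleStar q.1.2 (transStar q.2 q.1.1.1) ∈ N} := by
    have e1 : Measurable fun q : ((Radon d × E d) × ℝ) × E d => zoom q.1.1.2 q.1.2 q.2 := by
      simp only [zoom_apply]
      exact (Real.measurable_exp.comp (measurable_snd.comp measurable_fst)).smul
        (measurable_snd.sub (measurable_snd.comp (measurable_fst.comp measurable_fst)))
    have e2 : Measurable fun q : ((Radon d × E d) × ℝ) × E d =>
        scaleStar q.1.2 (transStar q.2 q.1.1.1) :=
      measurable_zoomed_base (measurable_snd.comp measurable_fst) measurable_snd
        (measurable_fst.comp (measurable_fst.comp measurable_fst))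
    exact (e1 hU.measurableSet).inter (e2 hN)
  have hS2 : MeasurableSet {q : (Radon d × E d) × ℝ | q.1.1.1 {x | zoom q.1.2 q.2 x ∈ U ∧
      scaleStar q.2 (transStar x q.1.1) ∈ N} = 0} :=
    measurable_measure_section (measurable_fst.comp measurable_fst) hS (measurableSet_singleton 0)
  rw [h.centering_apply_eq_zero_iff hb hN]
  -- Fixing `r` first leaves a condition on `p` alone, to which adaptedness applies.
  have hswap := Measure.ae_ae_comm (μ := Q) (ν := unifIco (Real.log b))
    (p := fun p r => scaleStar r (transStar p.2 p.1) ∉ N) (measurableSet_zoomed hN).compl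
  rw [hswap]
  have h1 := (Measure.ae_ae_comm (μ := Q) (ν := unifIco (Real.log b))
    (p := fun p r => p.1.1 {x | zoom p.2 r x ∈ U ∧ scaleStar r (transStar x p.1) ∈ N} = 0)
    hS2).mp (Measure.ae_ae_of_ae_prod hnull)
  filter_upwards [h1] with r hr
  have hgood : MeasurableSet {p : Radon d × E d | scaleStar r (transStar p.2 p.1) ∉ N} :=
    (measurable_zoomed_base measurable_const measurable_snd measurable_fst hN).compl
  have hbad : MeasurableSet {p : Radon d × E d |
      p.1.1 {x | zoom p.2 r x ∈ U ∧ scaleStar r (transStar x p.1) ∈ N} = 0} :=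
    measurable_prodMk_right hS2
  rw [ae_iff_of_adapted measurableSet_B1 h.adapted hgood]
  rw [ae_iff_of_adapted measurableSet_B1 h.adapted hbad] at hr
  filter_upwards [hr] with p hp
  have hV : {v : E d | Real.exp r • v ∈ U} ∈ 𝓝 (0 : E d) := by
    have : Tendsto (fun v : E d => Real.exp r • v) (𝓝 0) (𝓝 (Real.exp r • 0)) :=
      tendsto_id.const_smul _
    rw [smul_zero] at this
    exact this (hU.mem_nhds h0)
  refine ae_of_locally_ae hV (hp.mono fun x hx => ?_)
  simpa only [not_not, mem_ofPred_eq, zoom_apply] using hx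

end IsExtendedCP

lemma IsTwoSided.ae_ae_spread {b : ℕ} [NeZero b] {Q₀ : Measure (Radon d × E d)}
    {L : Measure (ℤ → Radon d × E d)} {ν : (ℤ → Radon d × E d) → Radon d}
    (h : IsTwoSided b Q₀ L ν) (hb : 2 ≤ b) {N : Set (Radon d)} (hN : MeasurableSet N)
    (hnull : centering b (L.map fun ω => (ν ω, (ω 0).2)) N = 0) :
    ∀ᵐ ω ∂L, ∀ᵐ x ∂(ν ω).1, ∀ᵐ r ∂unifIco (Real.log b), scaleStar r (transStar x (ν ω)) ∉ N := by
  have hQ := h.isExtendedCP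
  have := hQ.prob
  have hc : 0 < Real.log b := Real.log_pos (by exact_mod_cast hb)
  have := isProbabilityMeasure_unifIco hc
  have h1 : ∀ m : ℕ, ∀ᵐ ω ∂L, ∀ᵐ x ∂((ν ω).1.restrict (B1 d)),
      ∀ᵐ r ∂unifIco (Real.log b),
        scaleStar r (transStar x (ν ω)) ∉ scaleStar (m * Real.log b) ⁻¹' N := by
    intro m
    have hNm := measurable_scaleStar (d := d) (m * Real.log b) hN
    -- Pulling `N` back by `m log b` in advance compensates the `m` magnification steps from time
    -- `-m` to the present.
    have e1 : centering b (L.map fun ω => (ν ω, (ω 0).2)) (scaleStar (m * Real.log b) ⁻¹' N) = 0 := by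
      rw [(hQ.scaleStar_preserving hb _).measure_preimage hN.nullMeasurableSet, hnull]
    rw [hQ.centering_apply_eq_zero_iff hb hNm] at e1
    have hg : MeasurableSet {p : Radon d × E d | ∀ᵐ r ∂unifIco (Real.log b),
        scaleStar r (transStar p.2 p.1) ∉ scaleStar (m * Real.log b) ⁻¹' N} := by
      have e2 := measurable_measure_prodMk_left (ν := unifIco (Real.log b))
        (measurableSet_zoomed hNm) (measurableSet_singleton 0)
      convert e2 using 1
      ext p
      simp only [mem_ofPred_eq, ae_iff, not_not]
      rfl
    rw [ae_iff_of_adapted measurableSet_B1 hQ.adapted hg] at e1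
    exact ae_of_ae_map h.measurable_pair.aemeasurable e1
  filter_upwards [h.ae_shift (ae_all_iff.mpr h1), h.ae_eq_cellStar, h.ae_concentrated,
    h.ae_shift h.ae_cell_ne_zero] with ω h1 h2 h3 h4
  set bad : Set (E d) := {x | ¬ ∀ᵐ r ∂unifIco (Real.log b), scaleStar r (transStar x (ν ω)) ∉ N}
    with hbad
  -- The measure `ν ω` is the magnification of the `ν` at time `-m`, so bad points in the enlarged
  -- cube come from points of `B1` that are exceptional for the pulled-back set.
  have key : ∀ m : ℕ, (ν ω).1 (bad ∩ cellHomothety (b ^ m) (ω (-m)).2 '' B1 d) = 0 := by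
    intro m
    have h5 := h4 (-m) m
    simp only [shift, zero_add] at h5
    have h6 := h1 (-m) m
    have hT : ∀ x, (∀ᵐ r ∂unifIco (Real.log b), scaleStar r (transStar x (ν (shift (-m) ω)))
        ∉ scaleStar (m * Real.log b) ⁻¹' N) →
        cellHomothety (b ^ m) (ω (-m)).2 x ∉ bad := by
      intro x hx hxb
      refine hxb ?_
      filter_upwards [hx, ae_mem_unifIco (Real.log b)] with r hr hr0 hrN
      refine hr ?_
      have e : transStar (cellHomothety (b ^ m) (ω (-m)).2 x) (ν ω)
          = scaleStar (m * Real.log b) (transStar x (ν (shift (-m) ω))) := by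
        conv_lhs => rw [h2 m]
        rw [transStar_cellStar _ _ _ h5]
        push_cast
        rw [Real.log_pow]
      rw [e, scaleStar_scaleStar hr0.1, add_comm, ← scaleStar_scaleStar (by positivity)] at hrN
      exact hrN
    rw [h2 m, cellStar, star_apply_eq_zero_iff (by rwa [push_apply]), push_apply]
    rw [ae_restrict_iff' measurableSet_B1, ae_iff] at h6
    refine measure_mono_null ?_ h6
    rintro x ⟨hx1, y, hy, hxy⟩
    obtain rfl := (cellHomothety (b ^ m) (ω (-m)).2).injective hxy
    exact fun hcon => hT y (hcon hy) hx1
  rw [ae_iff]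
  refine measure_mono_null ?_ (measure_union_null h3 (measure_iUnion_null key))
  intro x hx
  by_cases hx2 : x ∈ ⋃ m : ℕ, cellHomothety (b ^ m) (ω (-m)).2 '' B1 d
  · obtain ⟨m, hm⟩ := mem_iUnion.mp hx2
    exact Or.inr (mem_iUnion.mpr ⟨m, hx, hm⟩)
  · exact Or.inl hx2

lemma IsTwoSided.bind_absolutelyContinuous {b : ℕ} [NeZero b] {Q₀ : Measure (Radon d × E d)}
    {L : Measure (ℤ → Radon d × E d)} {ν : (ℤ → Radon d × E d) → Radon d}
    (h : IsTwoSided b Q₀ L ν) (hb : 2 ≤ b) {U : Set (E d)} (hU : MeasurableSet U) :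
    (centering b (L.map fun ω => (ν ω, (ω 0).2))).bind (diffusion U)
      ≪ centering b (L.map fun ω => (ν ω, (ω 0).2)) := by
  refine Measure.AbsolutelyContinuous.mk fun N hN hnull => ?_
  have hQ := h.isExtendedCP
  have := hQ.prob
  have hc : 0 < Real.log b := Real.log_pos (by exact_mod_cast hb)
  have := isProbabilityMeasure_unifIco hc
  rw [hQ.bind_diffusion_eq_zero_iff hb hU hN, suspMeasure]
  have hS : MeasurableSet {q : ((Radon d × E d) × ℝ) × E d |
      scaleStar q.1.2 (transStar q.2 q.1.1.1) ∈ N} :=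
    measurable_zoomed_base (measurable_snd.comp measurable_fst) measurable_snd
      (measurable_fst.comp (measurable_fst.comp measurable_fst)) hN
  have hS2 : MeasurableSet {q : (Radon d × E d) × ℝ |
      q.1.1.1 {x | scaleStar q.2 (transStar x q.1.1) ∈ N} = 0} :=
    measurable_measure_section (measurable_fst.comp measurable_fst) hS (measurableSet_singleton 0)
  have h1 : ∀ᵐ q ∂(L.map fun ω => (ν ω, (ω 0).2)).prod (unifIco (Real.log b)),
      q.1.1.1 {x | scaleStar q.2 (transStar x q.1.1) ∈ N} = 0 := by
    refine (Measure.ae_prod_mem_iff_ae_ae_mem hS2).mpr ?_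
    have hm : MeasurableSet {p : Radon d × E d | ∀ᵐ r ∂unifIco (Real.log b),
        (p, r) ∈ {q : (Radon d × E d) × ℝ |
          q.1.1.1 {x | scaleStar q.2 (transStar x q.1.1) ∈ N} = 0}} :=
      measurable_measure_prodMk_left (ν := unifIco (Real.log b)) hS2.compl
        (measurableSet_singleton 0)
    rw [ae_map_iff h.measurable_pair.aemeasurable hm]
    filter_upwards [h.ae_ae_spread hb hN hnull] with ω hω
    -- The null set of points may depend on `r`; exchanging quantifiers gives, for almost every `r`,
    -- a null set of bad points in all of space, hence in every `U`.
    have hswap := Measure.ae_ae_comm (μ := (ν ω).1) (ν := unifIco (Real.log b))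
      (p := fun x r => scaleStar r (transStar x (ν ω)) ∉ N)
      (measurable_zoomed_base measurable_snd measurable_fst measurable_const hN).compl
    filter_upwards [hswap.mp hω] with r hr
    rw [ae_iff] at hr
    simpa using hr
  filter_upwards [h1] with q hq using measure_mono_null (fun x hx => hx.2) hq

end CPCentering

theorem mainTheorem3 (d b : ℕ) [NeZero b] (hb : 2 ≤ b)
    (Q : Measure (CPCentering.Radon d × CPCentering.E d)) (hQ : CPCentering.IsCP b Q) :
    CPCentering.IsFD (CPCentering.centering b Q) ∧
    CPCentering.IsFactor
      (CPCentering.centering b Q) CPCentering.scaleStar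
      (CPCentering.suspMeasure (Real.log b) Q)
      (CPCentering.suspFlow (Real.log b) (CPCentering.magStar b)) := by
  obtain ⟨Q₀, hQ₀, L, ν, h1, h2, h3, h4, h5, rfl⟩ := hQ
  have h : CPCentering.IsTwoSided b Q₀ L ν := ⟨hQ₀, h1, h2, h3, h4, h5⟩
  have hE := h.isExtendedCP
  exact ⟨⟨hE.isProbabilityMeasure_centering hb, hE.ae_centering_mem_MStar hb,
    hE.scaleStar_preserving hb, fun U hU _ h0 => ⟨hE.absolutelyContinuous_bind hb hU h0,
      h.bind_absolutelyContinuous hb hU.measurableSet⟩⟩, hE.isFactor_centering hb⟩
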